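/- Let $N$ be a number of sites, $\eta\in\mathbb C$ with $\eta\neq 0$, $\xi_1,\dots,\xi_N\in\mathbb C$, and let $K\in\operatorname{End}(\mathbb C^2)$ be a $2\times 2$ matrix. Let $R(\lambda)=\lambda\,I+\eta\,P\in\operatorname{End}(\mathbb C^2\otimes\mathbb C^2)$ be the rational 6-vertex $R$-matrix, where $P$ is the permutation operator. On $V_a\otimes\mathcal H$, with $V_a=\mathbb C^2$ and $\mathcal H=(\mathbb C^2)^{\otimes N}$, let $$M^{(K)}_a(\lambda)=K_aR_{a,N}(\lambda-\xi_N)\cdots R_{a,1}(\lambda-\xi_1)=\begin{pmatrix}A(\lambda)&B(\lambda)\\ C(\lambda)&D(\lambda)\end{pmatrix},\qquad T(\lambda)=\operatorname{tr}_{V_a}M^{(K)}_a(\lambda)\in\operatorname{End}(\mathcal H),$$ and put $d(\lambda)=\prod_{n=1}^N(\lambda-\xi_n)$, $a(\lambda)=d(\lambda+\eta)$ and $g_a(\lambda)=\prod_{b\ne a}\frac{\lambda-\xi_b}{\xi_a-\xi_b}$. A function $t:\mathbb C\to\mathbb C$ is called an eigenvalue of the family $T(\lambda)$ if there is $v\in\mathcal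 H$, $v\neq0$, with $T(\lambda)v=t(\lambda)v$ for all $\lambda\in\mathbb C$; such a $v$ is an eigenvector for $t$. For a covector $\langle S|\in\mathcal H^*$ and $h\in\{0,1\}^N$ put $$\langle h_1,\dots,h_N|=\langle S|\prod_{n=1}^N\Big(\frac{T(\xi_n)}{a(\xi_n)}\Big)^{h_n}.$$ Theorem. Assume that $K\neq\alpha I$ for every $\alpha\in\mathbb C$, and that $\xi_a\neq\xi_b+r\eta$ for all $a\neq b$ and $r\in\{-1,0,1\}$. Then: 1. A function $t$ is an eigenvalue of $T(\lambda)$ if and only if $$t(\lambda)=\operatorname{tr}K\prod_{a=1}^N(\lambda-\xi_a)+\sum_{a=1}^Ng_a(\lambda)\,x_a$$ for some solution $(x_1,\dots,x_N)\in\mathbb C^N$ of the $N$ quadratic equations $$x_n\Big[\operatorname{tr}K\prod_{a=1}^N(\xi_n-\xi_a-\eta)+\sum_{a=1}^Ng_a(\xi_n-\eta)\,x_a\Big]=a(\xi_n)\,d(\xi_n-\eta)\det K,\qquad n=1,\dots,N.$$ These equations say that $t(\xi_n)\,t(\xi_n-\eta)$ equals the value at $\xi_n$ of the quantum determinant, since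 $A(\lambda)D(\lambda-\eta)-B(\lambda)C(\lambda-\eta)=a(\lambda)\,d(\lambda-\eta)\det K\cdot I$ for all $\lambda$. 2. The spectrum of $T(\lambda)$ is $w$-simple: each eigenvalue $t$ has exactly one eigenvector up to a scalar factor. 3. Whenever $(x,y)$ and $(x,y)K$ are linearly independent, the tensor product covector $\langle S|=\bigotimes_{a=1}^N(x,y)_a$ makes $\{\langle h_1,\dots,h_N|\}_{h\in\{0,1\}^N}$ a basis of $\mathcal H^*$. This is a basis for Lebesgue-almost every $(x,y)\in\mathbb C^2$. 4. Let $\langle S|\in\mathcal H^*$ be any covector for which $\{\langle h_1,\dots,h_N|\}_{h\in\{0,1\}^N}$ is a basis of $\mathcal H^*$. Then each eigenvalue $t$ has a unique eigenvector $|t\rangle$ with $\langle S|t\rangle=1$, and $$\langle h_1,\dots,h_N|t\rangle=\prod_{n=1}^N\Big(\frac{t(\xi_n)}{a(\xi_n)}\Big)^{h_n}\qquad\text{for all }h\in\{0,1\}^N.$$ -/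

import Mathlib

open Matrix MeasureTheory

namespace SixVertex

/-- Labels of the canonical basis of `ℋ = (ℂ²)^{⊗ N}`: one label in `{0, 1}` for every site. -/
abbrev Config (N : ℕ) : Type := Fin N → Fin 2

/-- `End ℋ`, as matrices in the canonical (tensor product) basis of `ℋ`. -/
abbrev Op (N : ℕ) : Type := Matrix (Config N) (Config N) ℂ

/-- The rational 6-vertex `R`-matrix `R(u) = u I + η P` on `ℂ² ⊗ ℂ²`, where `P` is the
permutation operator. Rows and columns are indexed by pairs (first factor, second factor). -/
def rMatrix (η u : ℂ) : Matrix (Fin 2 × Fin 2) (Fin 2 × Fin 2) ℂ :=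
  Matrix.of fun p q => (if p = q then u else 0) + (if p = q.swap then η else 0)

/-- The explicit `4 × 4` form of the `R`-matrix, in the basis
`e₀ ⊗ e₀, e₀ ⊗ e₁, e₁ ⊗ e₀, e₁ ⊗ e₁`. -/
theorem rMatrix_explicit (η u : ℂ) :
    (rMatrix η u).submatrix ![(0, 0), (0, 1), (1, 0), (1, 1)] ![(0, 0), (0, 1), (1, 0), (1, 1)] =
      !![u + η, 0, 0, 0;
         0, u, η, 0;
         0, η, u, 0;
         0, 0, 0, u + η] := by
  ext i j
  fin_cases i <;> fin_cases j <;> simp [rMatrix]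

/-- The operator on `ℋ` that acts as `A` on site `n` and as the identity on the other sites. -/
def siteOp {N : ℕ} (n : Fin N) (A : Matrix (Fin 2) (Fin 2) ℂ) : Op N :=
  Matrix.of fun s s' => if ∀ m, m ≠ n → s m = s' m then A (s n) (s' n) else 0

/-- `R_{a,n}(u) ∈ End (V_a ⊗ ℋ)`, acting on the auxiliary space `V_a = ℂ²` and on site `n`,
written as a `2 × 2` matrix in `V_a` whose entries are operators on `ℋ`. -/
def rAux {N : ℕ} (η u : ℂ) (n : Fin N) : Matrix (Fin 2) (Fin 2) (Op N) :=
  Matrix.of fun i j => siteOp n (Matrix.of fun k l => rMatrix η u (i, k) (j, l))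

/-- The twist `K_a ∈ End (V_a ⊗ ℋ)`, acting as `K` on `V_a` and trivially on `ℋ`. -/
def twistAux (N : ℕ) (K : Matrix (Fin 2) (Fin 2) ℂ) : Matrix (Fin 2) (Fin 2) (Op N) :=
  K.map fun c => c • (1 : Op N)

/-- The monodromy matrix `M_a(u) = K_a R_{a,N}(u - ξ_N) ⋯ R_{a,1}(u - ξ_1)`; its entries are the
operators `A(u), B(u), C(u), D(u)` (row by row). -/
def monodromy {N : ℕ} (K : Matrix (Fin 2) (Fin 2) ℂ) (η : ℂ) (ξ : Fin N → ℂ) (u : ℂ) :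
    Matrix (Fin 2) (Fin 2) (Op N) :=
  twistAux N K * (List.ofFn fun n : Fin N => rAux η (u - ξ n) n).reverse.prod

/-- The transfer matrix `T(u) = tr_{V_a} M_a(u)`. -/
def transfer {N : ℕ} (K : Matrix (Fin 2) (Fin 2) ℂ) (η : ℂ) (ξ : Fin N → ℂ) (u : ℂ) : Op N :=
  (monodromy K η ξ u).trace

/-- `d(u) = ∏ₙ (u - ξₙ)`. -/
def dFun {N : ℕ} (ξ : Fin N → ℂ) (u : ℂ) : ℂ := ∏ n, (u - ξ n)

/-- `a(u) = d(u + η)`. -/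
def aFun {N : ℕ} (η : ℂ) (ξ : Fin N → ℂ) (u : ℂ) : ℂ := dFun ξ (u + η)

/-- `g_a(u) = ∏_{b ≠ a} (u - ξ_b) / (ξ_a - ξ_b)`. -/
noncomputable def gFun {N : ℕ} (ξ : Fin N → ℂ) (a : Fin N) (u : ℂ) : ℂ :=
  ∏ b ∈ Finset.univ.erase a, (u - ξ b) / (ξ a - ξ b)

/-- The quantum determinant `A(u) D(u - η) - B(u) C(u - η)`. -/
def quantumDet {N : ℕ} (K : Matrix (Fin 2) (Fin 2) ℂ) (η : ℂ) (ξ : Fin N → ℂ) (u : ℂ) : Op N :=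
  monodromy K η ξ u 0 0 * monodromy K η ξ (u - η) 1 1 -
    monodromy K η ξ u 0 1 * monodromy K η ξ (u - η) 1 0

/-- The inhomogeneity condition: `ξ_a ≠ ξ_b + r η` for all `a ≠ b` and `r ∈ {-1, 0, 1}`. -/
def InhomogeneityCondition {N : ℕ} (η : ℂ) (ξ : Fin N → ℂ) : Prop :=
  ∀ a b : Fin N, a ≠ b → ∀ r ∈ ({-1, 0, 1} : Set ℤ), ξ a ≠ ξ b + (r : ℂ) * η

/-- `v` solves `T(u) v = t(u) v` for all `u`. -/
def IsJointEigen {N : ℕ} (T : ℂ → Op N) (t : ℂ → ℂ) (v : Config N → ℂ) : Prop :=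
  ∀ u, T u *ᵥ v = t u • v

/-- The set of eigenvalues `t(u)` of the one-parameter family `T(u)`. -/
def spectrumOf {N : ℕ} (T : ℂ → Op N) : Set (ℂ → ℂ) :=
  {t | ∃ v, v ≠ 0 ∧ IsJointEigen T t v}

/-- The family `T(u)` is `w`-simple: every eigenvalue `t(u)` has exactly one eigenvector,
up to multiplication by a scalar. -/
def IsWSimple {N : ℕ} (T : ℂ → Op N) : Prop :=
  ∀ t ∈ spectrumOf T, ∃ v, v ≠ 0 ∧ ∀ w, IsJointEigen T t w ↔ ∃ c : ℂ, w = c • v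

/-- The polynomial `tr K ∏ₐ (u - ξₐ) + ∑ₐ gₐ(u) xₐ`. -/
noncomputable def tPoly {N : ℕ} (K : Matrix (Fin 2) (Fin 2) ℂ) (ξ : Fin N → ℂ) (x : Fin N → ℂ)
    (u : ℂ) : ℂ :=
  K.trace * ∏ a, (u - ξ a) + ∑ a, gFun ξ a u * x a

/-- The solutions `x` of the system of `N` quadratic equations
`xₙ [tr K ∏ₐ (ξₙ - ξₐ - η) + ∑ₐ gₐ(ξₙ - η) xₐ] = a(ξₙ) d(ξₙ - η) det K`. -/
def quadraticSolutions {N : ℕ} (K : Matrix (Fin 2) (Fin 2) ℂ) (η : ℂ) (ξ : Fin N → ℂ) :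
    Set (Fin N → ℂ) :=
  {x | ∀ n, x n * (K.trace * ∏ a, (ξ n - ξ a - η) + ∑ a, gFun ξ a (ξ n - η) * x a) =
    aFun η ξ (ξ n) * dFun ξ (ξ n - η) * K.det}

/-- The covector `⟨h₁, …, h_N| = ⟨S| ∏ₙ (T(ξₙ) / a(ξₙ))^{hₙ}`, with the factors ordered from
`n = 1` to `n = N` (they commute). Covectors are given by their coordinates in the dual of the
canonical basis. -/
noncomputable def sovCovector {N : ℕ} (K : Matrix (Fin 2) (Fin 2) ℂ) (η : ℂ) (ξ : Fin N → ℂ)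
    (S : Config N → ℂ) (h : Config N) : Config N → ℂ :=
  S ᵥ* (List.ofFn fun n : Fin N =>
    ((aFun η ξ (ξ n))⁻¹ • transfer K η ξ (ξ n)) ^ (h n : ℕ)).prod

/-- The covectors `⟨h₁, …, h_N|`, `h ∈ {0,1}^N`, form a basis of `ℋ*`. -/
def IsSoVBasis {N : ℕ} (K : Matrix (Fin 2) (Fin 2) ℂ) (η : ℂ) (ξ : Fin N → ℂ)
    (S : Config N → ℂ) : Prop :=
  LinearIndependent ℂ (sovCovector K η ξ S) ∧
    Submodule.span ℂ (Set.range (sovCovector K η ξ S)) = ⊤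

/-- The tensor product covector `⊗ₙ (x, y)ₙ`. -/
def tensorCovector (N : ℕ) (x y : ℂ) : Config N → ℂ := fun s => ∏ n, ![x, y] (s n)

end SixVertex

open SixVertex

/-!
The proof has an algebraic half, about the operators `T(u)`, and a construction of covectors.

*Algebra.* Three properties of a pair of monodromy matrices `M_a = M(u)`, `M'_b = M(w)` pass from the
factors of single sites to the whole chain, because the entries of factors at different sites
commute: the RTT relation (`RTT.mul`), the fact that for `w = u - η` the product `M_a M'_b` is a
scalar `q` on the antisymmetric vector of `V_a ⊗ V_b` (`HasQDet.mul`), and the fact that it takes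
antisymmetric values only (`RowAntisymm.mul_left`, `RowAntisymm.mul_right`); the last one holds at
`u = ξₙ`, where the factor of site `n` is a permutation operator. They give, in this order, the
commutativity of the `T(u)`, the quantum determinant, and the fusion relation
`T(ξₙ) T(ξₙ - η) = a(ξₙ) d(ξₙ - η) det K` (`transfer_mul_transfer`). Since `T(u)` is a polynomial of degree at
most `N` in `u` whose coefficient of `u^N` is `tr K`, an eigenvalue is determined by its values
`xₙ = t(ξₙ)`, and the fusion relation is the quadratic system. Conversely, given an SoV basis, a solution
`x` prescribes a vector `v` by `⟨h|v⟩ = ∏ (xₙ / a(ξₙ))^{hₙ}`. On `⟨h|` the operators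
`T(ξₙ - hₙ η)` only flip the label `hₙ`, by commutativity and fusion, so `⟨h|T(u)|v⟩ = t(u)⟨h|v⟩` holds
at the `N` distinct points `ξₙ - hₙ η`, hence everywhere (`exists_eigenvector`). The same wave
function computed for an arbitrary eigenvector shows that it is unique up to a scalar.

*SoV basis.* Let `Γ` have the rows `s = (x, y)` and `s K`. After the change of basis `Γ` in `V_a`, with
entries `A, B, C, D`, the twist becomes a companion matrix, so `T(u) = C(u) + b B(u) + d D(u)` with
numbers `b, d`. The covector `S = s ⊗ ⋯ ⊗ s` is an eigenvector of `D(u)`, and the RTT relation with the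
quantum determinant shows that `S ∏ C(ξₙ)^{hₙ}` is a nonzero eigenvector of `D(u)` with eigenvalue
`∏ (u - ξₙ + hₙ η)` (`eigen_step`). These eigenvalues separate the `h`, so the `2^N` covectors form a
basis (`linearIndependent_of_eigen`). In the filtration by the number of tensor factors `s K`, `C`
raises the degree by one, `D` preserves it and `B` lowers it, so `S ∏ T(ξₙ)^{hₙ}` has the leading
part `S ∏ C(ξₙ)^{hₙ}`, and the change of basis is triangular (`span_eq_top_of_triangular`).
-/

namespace SixVertex

/-! ### Monodromy matrices over a noncommutative algebra -/

section Algebra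

variable {A : Type*} [Ring A]

/-- Every entry of `M` commutes with every entry of `M'`. -/
def EntriesCommute (M M' : Matrix (Fin 2) (Fin 2) A) : Prop :=
  ∀ i j k l, Commute (M i j) (M' k l)

theorem mul_mul_mul_entries {L L' M M' : Matrix (Fin 2) (Fin 2) A} (h : EntriesCommute M L')
    (i j k l : Fin 2) :
    (L * M) i j * (L' * M') k l = ∑ p, ∑ q, L i p * L' k q * (M p j * M' q l) := by
  simp only [Matrix.mul_apply, Finset.sum_mul_sum]
  refine Finset.sum_congr rfl fun p _ => Finset.sum_congr rfl fun q _ => ?_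
  have := (h p j k q).eq
  rw [mul_assoc, ← mul_assoc (M p j), this]; simp only [mul_assoc]

theorem EntriesCommute.mul_left {L M N : Matrix (Fin 2) (Fin 2) A} (h : EntriesCommute L N)
    (h' : EntriesCommute M N) : EntriesCommute (L * M) N := by
  intro i j k l
  rw [Matrix.mul_apply]
  exact Commute.sum_left _ _ _ fun p _ => (h i p k l).mul_left (h' p j k l)

theorem EntriesCommute.symm {M N : Matrix (Fin 2) (Fin 2) A} (h : EntriesCommute M N) :
    EntriesCommute N M := fun i j k l => (h k l i j).symm

/-- The product `M_a M'_b` has its image in the antisymmetric vectors of `V_a ⊗ V_b`: its components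
are antisymmetric in the two row indices. -/
def RowAntisymm (M M' : Matrix (Fin 2) (Fin 2) A) : Prop :=
  ∀ i j k l, M i j * M' k l = -(M k j * M' i l)

theorem RowAntisymm.mul_right {L L' M M' : Matrix (Fin 2) (Fin 2) A} (hL : RowAntisymm L L')
    (h : EntriesCommute M L') : RowAntisymm (L * M) (L' * M') := by
  intro i j k l
  rw [mul_mul_mul_entries h, mul_mul_mul_entries h]
  simp only [← Finset.sum_neg_distrib]
  refine Finset.sum_congr rfl fun p _ => Finset.sum_congr rfl fun q _ => ?_
  rw [hL i p k q, neg_mul]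

variable [Algebra ℂ A]

/-- The Yang–Baxter (RTT) relation `R(u) M_a M'_b = M'_b M_a R(u)`, in components. For `M = M(u₁)` and
`M' = M(u₂)` the parameter `u` is the difference `u₁ - u₂`. -/
def RTT (η u : ℂ) (M M' : Matrix (Fin 2) (Fin 2) A) : Prop :=
  ∀ i j k l, u • (M i j * M' k l) + η • (M k j * M' i l) =
    u • (M' k l * M i j) + η • (M' k j * M i l)

/-- The antisymmetric tensor on two indices, with `levi 0 1 = 1`. -/
def levi : Matrix (Fin 2) (Fin 2) ℂ := !![0, 1; -1, 0]

/-- On the antisymmetric vector of `V_a ⊗ V_b`, the product `M_a M'_b` acts as the scalar `q`. The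
component `i = 0`, `k = 1` reads `A D' - B C' = q`, and `i = 1`, `k = 0` reads `D A' - C B' = q`. -/
def HasQDet (M M' : Matrix (Fin 2) (Fin 2) A) (q : ℂ) : Prop :=
  ∀ i k, M i 0 * M' k 1 - M i 1 * M' k 0 = (levi i k * q) • (1 : A)

/-- The RTT relation is stable under products of matrices with commuting entries. -/
theorem RTT.mul {η u : ℂ} {L L' M M' : Matrix (Fin 2) (Fin 2) A} (hL : RTT η u L L')
    (hM : RTT η u M M') (h : EntriesCommute M L') (h' : EntriesCommute M' L) :
    RTT η u (L * M) (L' * M') := by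
  intro i j k l
  rw [mul_mul_mul_entries h, mul_mul_mul_entries h, mul_mul_mul_entries h',
    mul_mul_mul_entries h']
  calc _ = ∑ p, ∑ q, (u • (L i p * L' k q) + η • (L k p * L' i q)) * (M p j * M' q l) := by
        simp only [Finset.smul_sum, ← Finset.sum_add_distrib, add_mul, smul_mul_assoc]
    _ = ∑ p, ∑ q, (u • (L' k q * L i p) + η • (L' k p * L i q)) * (M p j * M' q l) := by
        simp only [hL i _ k _]
    _ = ∑ p, ∑ q, L' k q * L i p * (u • (M p j * M' q l) + η • (M q j * M' p l)) := by
        simp only [Fin.sum_univ_two, add_mul, mul_add, smul_mul_assoc, mul_smul_comm]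
        abel
    _ = ∑ p, ∑ q, L' k q * L i p * (u • (M' q l * M p j) + η • (M' q j * M p l)) := by
        simp only [hM _ j _ l]
    _ = _ := by
        simp only [Fin.sum_univ_two, mul_add, mul_smul_comm, smul_add]
        abel

/-- The quantum determinant is multiplicative. -/
theorem HasQDet.mul {L L' M M' : Matrix (Fin 2) (Fin 2) A} {q r : ℂ} (hL : HasQDet L L' q)
    (hM : HasQDet M M' r) (h : EntriesCommute M L') : HasQDet (L * M) (L' * M') (q * r) := by
  intro i k
  have e : ∀ p s, M p 0 * M' s 1 = M p 1 * M' s 0 + (levi p s * r) • (1 : A) :=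
    fun p s => by rw [← hM p s]; abel
  have := congrArg (r • ·) (hL i k)
  rw [mul_mul_mul_entries h, mul_mul_mul_entries h]
  simp only [e, mul_add, Finset.sum_add_distrib]
  simp only [levi, Fin.sum_univ_two, mul_smul_comm, mul_one, of_apply, cons_val', cons_val_zero,
    cons_val_one, cons_val_fin_one] at this ⊢
  linear_combination (norm := module) this

theorem RowAntisymm.mul_left {L L' M M' : Matrix (Fin 2) (Fin 2) A} {q : ℂ}
    (hL : HasQDet L L' q) (hM : RowAntisymm M M') (h : EntriesCommute M L') :
    RowAntisymm (L * M) (L' * M') := by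
  have key : ∀ i j k l, (L * M) i j * (L' * M') k l = (levi i k * q) • (M 0 j * M' 1 l) := by
    intro i j k l
    have h0 : ∀ x : A, x = -x → x = 0 := fun x hx => by
      have : (2 : ℂ) • x = 0 := by linear_combination (norm := module) hx
      simpa using this
    have h1 := h0 _ (hM 1 j 1 l)
    replace h0 := h0 _ (hM 0 j 0 l)
    rw [mul_mul_mul_entries h, ← one_mul (M 0 j * M' 1 l), ← smul_mul_assoc, ← hL i k]
    simp only [Fin.sum_univ_two, h0, h1, hM 1 j 0 l]
    noncomm_ring
  intro i j k l
  rw [key, key, ← neg_smul]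
  congr 1
  fin_cases i <;> fin_cases k <;> simp [levi]

/-- Traces of monodromy matrices commute: the diagonal commutators vanish one by one, and the two
mixed ones, `[A, D']` and `[D, A']`, cancel each other. -/
theorem RTT.commute_trace {η u : ℂ} {M M' : Matrix (Fin 2) (Fin 2) A} (hη : η ≠ 0) (hu : u ≠ 0)
    (h : RTT η u M M') (h' : RTT η (-u) M' M) : Commute M.trace M'.trace := by
  have diag : ∀ i, M i i * M' i i - M' i i * M i i = 0 := by
    intro i
    have : (2 * η) • (M i i * M' i i - M' i i * M i i) = 0 := by
      linear_combination (norm := module) h i i i i - h' i i i i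
    simpa [hη] using this
  have mixed : M 0 0 * M' 1 1 - M' 1 1 * M 0 0 + (M 1 1 * M' 0 0 - M' 0 0 * M 1 1) = 0 := by
    have : u • (M 0 0 * M' 1 1 - M' 1 1 * M 0 0 + (M 1 1 * M' 0 0 - M' 0 0 * M 1 1)) = 0 := by
      linear_combination (norm := module) h 0 0 1 1 + h' 0 0 1 1
    exact (smul_eq_zero.mp this).resolve_left hu
  have e0 := diag 0
  have e1 := diag 1
  rw [Commute, SemiconjBy, ← sub_eq_zero]
  simp only [Matrix.trace_fin_two, add_mul, mul_add]
  linear_combination (norm := module) e0 + e1 + mixed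

/-- Fusion: if `M_a M'_b` has its image in the antisymmetric vectors, then the product of the traces
is the quantum determinant. -/
theorem RowAntisymm.trace_mul_trace {M M' : Matrix (Fin 2) (Fin 2) A} {q : ℂ}
    (h : RowAntisymm M M') (hq : HasQDet M M' q) : M.trace * M'.trace = q • (1 : A) := by
  have h0 : ∀ x : A, x = -x → x = 0 := fun x hx => by
    have : (2 : ℂ) • x = 0 := by linear_combination (norm := module) hx
    simpa using this
  have e := hq 0 1
  have e0 := h0 _ (h 0 0 0 0)
  have e1 := h0 _ (h 1 1 1 1)
  have e2 := h 0 1 1 0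
  simp only [levi, of_apply, cons_val', cons_val_zero, cons_val_one, cons_val_fin_one] at e
  simp only [Matrix.trace_fin_two, add_mul, mul_add]
  linear_combination (norm := module) e + e0 + e1 + e2

/-- A numerical matrix, acting on `V_a` alone. -/
def scalarAux (A : Type*) [Ring A] [Algebra ℂ A] :
    Matrix (Fin 2) (Fin 2) ℂ →ₐ[ℂ] Matrix (Fin 2) (Fin 2) A :=
  (Algebra.ofId ℂ A).mapMatrix

theorem scalarAux_apply (K : Matrix (Fin 2) (Fin 2) ℂ) (i j : Fin 2) :
    scalarAux A K i j = K i j • (1 : A) := by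
  simp [scalarAux, Algebra.ofId_apply, Algebra.algebraMap_eq_smul_one]

theorem entriesCommute_scalarAux (K : Matrix (Fin 2) (Fin 2) ℂ) (M : Matrix (Fin 2) (Fin 2) A) :
    EntriesCommute (scalarAux A K) M := by
  intro i j k l
  rw [scalarAux_apply]
  exact (Commute.one_left _).smul_left _

theorem rtt_scalarAux (η u : ℂ) (K : Matrix (Fin 2) (Fin 2) ℂ) :
    RTT η u (scalarAux A K) (scalarAux A K) := by
  intro i j k l
  simp only [scalarAux_apply, smul_mul_smul_comm, mul_one, smul_smul, ← add_smul]
  congr 1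
  ring

theorem hasQDet_scalarAux (K : Matrix (Fin 2) (Fin 2) ℂ) :
    HasQDet (scalarAux A K) (scalarAux A K) K.det := by
  intro i k
  simp only [scalarAux_apply, smul_mul_smul_comm, mul_one, ← sub_smul, Matrix.det_fin_two]
  congr 1
  fin_cases i <;> fin_cases k <;> simp [levi] <;> ring

theorem trace_scalarAux_mul (K : Matrix (Fin 2) (Fin 2) ℂ) (M : Matrix (Fin 2) (Fin 2) A) :
    (scalarAux A K * M).trace = ∑ i, ∑ j, K i j • M j i := by
  simp [Matrix.trace, Matrix.mul_apply, scalarAux_apply]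

theorem trace_mul_scalarAux (K : Matrix (Fin 2) (Fin 2) ℂ) (M : Matrix (Fin 2) (Fin 2) A) :
    (M * scalarAux A K).trace = (scalarAux A K * M).trace := by
  rw [trace_scalarAux_mul, Finset.sum_comm]
  simp [Matrix.trace, Matrix.mul_apply, scalarAux_apply]

end Algebra

/-! ### Operators on a single site -/

section Sites

variable {N : ℕ}

theorem siteOp_mulVec (n : Fin N) (A : Matrix (Fin 2) (Fin 2) ℂ) (v : Config N → ℂ)
    (s : Config N) :
    (siteOp n A *ᵥ v) s = ∑ k, A (s n) k * v (Function.update s n k) := by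
  classical
  have hinj : Function.Injective fun k : Fin 2 => Function.update s n k :=
    Function.update_injective s n
  rw [Matrix.mulVec, dotProduct,
    ← Finset.sum_subset (Finset.subset_univ (Finset.univ.map ⟨_, hinj⟩)), Finset.sum_map]
  · refine Finset.sum_congr rfl fun k _ => ?_
    simp only [siteOp, of_apply, Function.Embedding.coeFn_mk]
    rw [if_pos fun m hm => (Function.update_of_ne hm _ _).symm, Function.update_self]
  · intro s' _ hs'
    simp only [siteOp, of_apply]
    rw [if_neg, zero_mul]
    intro h
    apply hs'
    simp only [Finset.mem_map, Finset.mem_univ, true_and, Function.Embedding.coeFn_mk]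
    refine ⟨s' n, funext fun m => ?_⟩
    by_cases hm : m = n
    · subst hm; simp
    · simp [hm, h m hm]

theorem siteOp_transpose (n : Fin N) (A : Matrix (Fin 2) (Fin 2) ℂ) :
    (siteOp n A)ᵀ = siteOp n Aᵀ := by
  ext s s'
  simp only [siteOp, transpose_apply, of_apply, eq_comm]

theorem vecMul_siteOp (n : Fin N) (A : Matrix (Fin 2) (Fin 2) ℂ) (v : Config N → ℂ)
    (s : Config N) :
    (v ᵥ* siteOp n A) s = ∑ k, v (Function.update s n k) * A k (s n) := by
  rw [← mulVec_transpose, siteOp_transpose, siteOp_mulVec]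
  simp [mul_comm]

/-- Operators on site `n`, as an algebra homomorphism. -/
def siteHom (n : Fin N) : Matrix (Fin 2) (Fin 2) ℂ →ₐ[ℂ] Op N :=
  AlgHom.ofLinearMap
    { toFun := siteOp n
      map_add' := fun A B => by
        ext s s'
        simp only [siteOp, of_apply, Matrix.add_apply]
        split_ifs <;> simp
      map_smul' := fun c A => by
        ext s s'
        simp only [siteOp, of_apply, Matrix.smul_apply]
        split_ifs <;> simp }
    (by
      refine Matrix.ext_of_mulVec_single fun s => ?_
      ext s'
      simp only [LinearMap.coe_mk, AddHom.coe_mk]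
      rw [siteOp_mulVec]
      simp only [one_mulVec, one_apply, ite_mul, one_mul, zero_mul, Finset.sum_ite_eq,
        Finset.mem_univ, if_true, Function.update_eq_self])
    (fun A B => by
      refine Matrix.ext_of_mulVec_single fun s => ?_
      ext s'
      simp only [LinearMap.coe_mk, AddHom.coe_mk]
      rw [← Matrix.mulVec_mulVec, siteOp_mulVec, siteOp_mulVec]
      simp only [siteOp_mulVec, Fin.sum_univ_two, Matrix.mul_apply, Function.update_self,
        Function.update_idem]
      ring)

theorem siteHom_apply (n : Fin N) (A : Matrix (Fin 2) (Fin 2) ℂ) : siteHom n A = siteOp n A := rfl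

theorem siteHom_commute {n m : Fin N} (h : n ≠ m) (A B : Matrix (Fin 2) (Fin 2) ℂ) :
    Commute (siteHom n A) (siteHom m B) := by
  refine Matrix.ext_of_mulVec_single fun s => ?_
  ext s'
  simp only [siteHom_apply, ← Matrix.mulVec_mulVec]
  simp only [siteOp_mulVec, Fin.sum_univ_two, Function.update_of_ne h, Function.update_of_ne h.symm,
    Function.update_comm h]
  ring

/-- The `R`-matrix `R(u)`, written as a `2 × 2` matrix in its first tensor factor whose entries are
operators on the second. -/
def rBlock (η u : ℂ) : Matrix (Fin 2) (Fin 2) (Matrix (Fin 2) (Fin 2) ℂ) :=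
  Matrix.of fun i j => Matrix.of fun k l => rMatrix η u (i, k) (j, l)

theorem rAux_eq (η u : ℂ) (n : Fin N) : rAux η u n = (siteHom n).mapMatrix (rBlock η u) := rfl

theorem rBlock_apply (η u : ℂ) (i j : Fin 2) :
    rBlock η u i j = (if i = j then u else 0) • 1 + η • Matrix.single j i 1 := by
  ext k l
  fin_cases i <;> fin_cases j <;> fin_cases k <;> fin_cases l <;> simp [rBlock, rMatrix]

/-- The Yang–Baxter equation. -/
theorem rtt_rBlock (η u w : ℂ) : RTT η (u - w) (rBlock η u) (rBlock η w) := by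
  intro i j k l
  ext a b
  fin_cases i <;> fin_cases j <;> fin_cases k <;> fin_cases l <;> fin_cases a <;> fin_cases b <;>
    simp [rBlock, rMatrix, Matrix.mul_apply] <;> first | ring1 | (left; ring1)

theorem hasQDet_rBlock (η u : ℂ) :
    HasQDet (rBlock η u) (rBlock η (u - η)) ((u + η) * (u - η)) := by
  intro i k
  ext a b
  fin_cases i <;> fin_cases k <;> fin_cases a <;> fin_cases b <;>
    simp [rBlock, rMatrix, Matrix.mul_apply, levi] <;> ring

theorem rowAntisymm_rBlock (η : ℂ) : RowAntisymm (rBlock η 0) (rBlock η (-η)) := by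
  intro i j k l
  ext a b
  fin_cases i <;> fin_cases j <;> fin_cases k <;> fin_cases l <;> fin_cases a <;> fin_cases b <;>
    simp [rBlock, rMatrix, Matrix.mul_apply]

variable {A B : Type*} [Ring A] [Algebra ℂ A] [Ring B] [Algebra ℂ B]

theorem RTT.map (φ : A →ₐ[ℂ] B) {η u : ℂ} {M M' : Matrix (Fin 2) (Fin 2) A} (h : RTT η u M M') :
    RTT η u (φ.mapMatrix M) (φ.mapMatrix M') := by
  intro i j k l
  simpa using congrArg φ (h i j k l)

theorem HasQDet.map (φ : A →ₐ[ℂ] B) {q : ℂ} {M M' : Matrix (Fin 2) (Fin 2) A}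
    (h : HasQDet M M' q) : HasQDet (φ.mapMatrix M) (φ.mapMatrix M') q := by
  intro i k
  simpa using congrArg φ (h i k)

theorem RowAntisymm.map (φ : A →ₐ[ℂ] B) {M M' : Matrix (Fin 2) (Fin 2) A}
    (h : RowAntisymm M M') : RowAntisymm (φ.mapMatrix M) (φ.mapMatrix M') := by
  intro i j k l
  simpa using congrArg φ (h i j k l)

end Sites

/-! ### Relations for the monodromy and transfer matrices -/

section Chain

variable {N : ℕ}

/-- The untwisted product `R_{a,n_1}(u - ξ_{n_1}) R_{a,n_2}(u - ξ_{n_2}) ⋯` over a list of sites. -/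
def chain (η : ℂ) (ξ : Fin N → ℂ) (l : List (Fin N)) (u : ℂ) : Matrix (Fin 2) (Fin 2) (Op N) :=
  (l.map fun n => rAux η (u - ξ n) n).prod

@[simp] theorem chain_nil (η : ℂ) (ξ : Fin N → ℂ) (u : ℂ) : chain η ξ [] u = 1 := rfl

@[simp] theorem chain_cons (η : ℂ) (ξ : Fin N → ℂ) (n : Fin N) (l : List (Fin N)) (u : ℂ) :
    chain η ξ (n :: l) u = rAux η (u - ξ n) n * chain η ξ l u := rfl

theorem chain_one_eq (N : ℕ) : (1 : Matrix (Fin 2) (Fin 2) (Op N)) = scalarAux (Op N) 1 :=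
  (map_one _).symm

theorem entriesCommute_chain_rAux (η : ℂ) (ξ : Fin N → ℂ) {n : Fin N} {l : List (Fin N)}
    (hn : n ∉ l) (u w : ℂ) : EntriesCommute (chain η ξ l u) (rAux η w n) := by
  induction l with
  | nil => rw [chain_nil, chain_one_eq]; exact entriesCommute_scalarAux _ _
  | cons m l ih =>
    rw [chain_cons]
    refine EntriesCommute.mul_left ?_ (ih (List.not_mem_of_not_mem_cons hn))
    intro i j k l
    exact siteHom_commute (fun h : m = n => hn (h ▸ List.mem_cons_self)) _ _

theorem rtt_chain (η : ℂ) (ξ : Fin N → ℂ) {l : List (Fin N)} (hl : l.Nodup) (u w : ℂ) :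
    RTT η (u - w) (chain η ξ l u) (chain η ξ l w) := by
  induction l with
  | nil => simp only [chain_nil, chain_one_eq]; exact rtt_scalarAux _ _ _
  | cons n l ih =>
    have hn := (List.nodup_cons.mp hl).1
    refine RTT.mul ?_ (ih (List.nodup_cons.mp hl).2) (entriesCommute_chain_rAux η ξ hn _ _)
      (entriesCommute_chain_rAux η ξ hn _ _)
    have := (rtt_rBlock η (u - ξ n) (w - ξ n)).map (siteHom n)
    rwa [sub_sub_sub_cancel_right] at this

theorem hasQDet_chain (η : ℂ) (ξ : Fin N → ℂ) {l : List (Fin N)} (hl : l.Nodup) (u : ℂ) :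
    HasQDet (chain η ξ l u) (chain η ξ l (u - η))
      (l.map fun n => (u - ξ n + η) * (u - ξ n - η)).prod := by
  induction l with
  | nil =>
    have := hasQDet_scalarAux (A := Op N) 1
    rw [det_one] at this
    simpa only [chain_nil, chain_one_eq, List.map_nil, List.prod_nil] using this
  | cons n l ih =>
    have hn := (List.nodup_cons.mp hl).1
    refine HasQDet.mul ?_ (ih (List.nodup_cons.mp hl).2) (entriesCommute_chain_rAux η ξ hn _ _)
    have := (hasQDet_rBlock η (u - ξ n)).map (siteHom n)
    simpa only [rAux_eq, sub_right_comm u η] using this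

/-- At `u = ξ_n` the factor of site `n` degenerates to the permutation operator, which transports
the antisymmetrizer to the auxiliary spaces. -/
theorem rowAntisymm_chain (η : ℂ) (ξ : Fin N → ℂ) {l : List (Fin N)} (hl : l.Nodup) {n : Fin N}
    (hn : n ∈ l) : RowAntisymm (chain η ξ l (ξ n)) (chain η ξ l (ξ n - η)) := by
  induction l with
  | nil => simp at hn
  | cons m l ih =>
    have hm := (List.nodup_cons.mp hl).1
    rw [chain_cons, chain_cons]
    rcases List.mem_cons.mp hn with rfl | hn
    · refine RowAntisymm.mul_right ?_ (entriesCommute_chain_rAux η ξ hm _ _)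
      rw [sub_self, sub_right_comm, sub_self, zero_sub]
      exact (rowAntisymm_rBlock η).map (siteHom n)
    · refine RowAntisymm.mul_left (q := (ξ n - ξ m + η) * (ξ n - ξ m - η)) ?_
        (ih (List.nodup_cons.mp hl).2 hn) (entriesCommute_chain_rAux η ξ hm _ _)
      have := (hasQDet_rBlock η (ξ n - ξ m)).map (siteHom m)
      simpa only [rAux_eq, sub_right_comm (ξ n) η] using this

/-- The sites in the order `N, …, 1` of the factors of the monodromy matrix. -/
def sites (N : ℕ) : List (Fin N) := (List.finRange N).reverse

theorem nodup_sites : (sites N).Nodup := List.nodup_reverse.mpr (List.nodup_finRange N)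

theorem mem_sites (n : Fin N) : n ∈ sites N := List.mem_reverse.mpr (List.mem_finRange n)

theorem prod_map_sites (f : Fin N → ℂ) : ((sites N).map f).prod = ∏ n, f n := by
  rw [sites, List.map_reverse, List.prod_reverse, ← List.ofFn_eq_map, List.prod_ofFn]

theorem monodromy_eq (K : Matrix (Fin 2) (Fin 2) ℂ) (η : ℂ) (ξ : Fin N → ℂ) (u : ℂ) :
    monodromy K η ξ u = scalarAux (Op N) K * chain η ξ (sites N) u := by
  rw [monodromy, chain, sites, List.map_reverse, List.ofFn_eq_map]
  congr 1
  ext i j : 1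
  rw [scalarAux_apply]; rfl

theorem aFun_mul_dFun (η : ℂ) (ξ : Fin N → ℂ) (u : ℂ) :
    aFun η ξ u * dFun ξ (u - η) = ∏ n, (u - ξ n + η) * (u - ξ n - η) := by
  rw [aFun, dFun, dFun, ← Finset.prod_mul_distrib]
  exact Finset.prod_congr rfl fun n _ => by ring

theorem hasQDet_monodromy (K : Matrix (Fin 2) (Fin 2) ℂ) (η : ℂ) (ξ : Fin N → ℂ) (u : ℂ) :
    HasQDet (monodromy K η ξ u) (monodromy K η ξ (u - η))
      (aFun η ξ u * dFun ξ (u - η) * K.det) := by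
  rw [monodromy_eq, monodromy_eq, mul_comm, aFun_mul_dFun, ← prod_map_sites]
  exact (hasQDet_scalarAux K).mul (hasQDet_chain η ξ nodup_sites u)
    (entriesCommute_scalarAux _ _).symm

theorem quantumDet_eq (K : Matrix (Fin 2) (Fin 2) ℂ) (η : ℂ) (ξ : Fin N → ℂ) (u : ℂ) :
    quantumDet K η ξ u = (aFun η ξ u * dFun ξ (u - η) * K.det) • (1 : Op N) := by
  simpa [levi, quantumDet] using hasQDet_monodromy K η ξ u 0 1

theorem rtt_monodromy (K : Matrix (Fin 2) (Fin 2) ℂ) (η : ℂ) (ξ : Fin N → ℂ) (u w : ℂ) :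
    RTT η (u - w) (monodromy K η ξ u) (monodromy K η ξ w) := by
  rw [monodromy_eq, monodromy_eq]
  exact (rtt_scalarAux _ _ K).mul (rtt_chain η ξ nodup_sites u w)
    (entriesCommute_scalarAux _ _).symm (entriesCommute_scalarAux _ _).symm

theorem transfer_commute (K : Matrix (Fin 2) (Fin 2) ℂ) {η : ℂ} (hη : η ≠ 0) (ξ : Fin N → ℂ)
    (u w : ℂ) : Commute (transfer K η ξ u) (transfer K η ξ w) := by
  by_cases h : u = w
  · rw [h]
  · refine RTT.commute_trace hη (sub_ne_zero.mpr h) (rtt_monodromy K η ξ u w) ?_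
    rw [neg_sub]
    exact rtt_monodromy K η ξ w u

/-- The fusion relation at the inhomogeneities. -/
theorem transfer_mul_transfer (K : Matrix (Fin 2) (Fin 2) ℂ) (η : ℂ) (ξ : Fin N → ℂ) (n : Fin N) :
    transfer K η ξ (ξ n) * transfer K η ξ (ξ n - η) =
      (aFun η ξ (ξ n) * dFun ξ (ξ n - η) * K.det) • (1 : Op N) := by
  refine RowAntisymm.trace_mul_trace ?_ (hasQDet_monodromy K η ξ (ξ n))
  rw [monodromy_eq, monodromy_eq]
  exact RowAntisymm.mul_left (hasQDet_scalarAux K) (rowAntisymm_chain η ξ nodup_sites (mem_sites n))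
    (entriesCommute_scalarAux _ _).symm

end Chain

/-! ### Polynomial functions with a given leading coefficient -/

section Leading

/-- `f` is a polynomial function of degree at most `n` whose coefficient of degree `n` is `c`. -/
def HasLead (n : ℕ) (c : ℂ) (f : ℂ → ℂ) : Prop :=
  ∃ P : Polynomial ℂ, P.degree ≤ n ∧ P.coeff n = c ∧ ∀ u, f u = P.eval u

theorem HasLead.add {n : ℕ} {c d : ℂ} {f g : ℂ → ℂ} (hf : HasLead n c f) (hg : HasLead n d g) :
    HasLead n (c + d) fun u => f u + g u := by
  obtain ⟨P, hP, hc, hf⟩ := hf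
  obtain ⟨Q, hQ, hd, hg⟩ := hg
  exact ⟨P + Q, (Polynomial.degree_add_le _ _).trans (max_le hP hQ), by simp [hc, hd],
    fun u => by simp [hf, hg]⟩

theorem HasLead.const_mul {n : ℕ} {c : ℂ} {f : ℂ → ℂ} (b : ℂ) (hf : HasLead n c f) :
    HasLead n (b * c) fun u => b * f u := by
  obtain ⟨P, hP, hc, hf⟩ := hf
  exact ⟨b • P, (Polynomial.degree_smul_le _ _).trans hP, by simp [hc],
    fun u => by simp [hf]⟩

theorem HasLead.sum {ι : Type*} {n : ℕ} {c : ι → ℂ} {f : ι → ℂ → ℂ} (s : Finset ι)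
    (hf : ∀ i, HasLead n (c i) (f i)) : HasLead n (∑ i ∈ s, c i) fun u => ∑ i ∈ s, f i u := by
  choose P hP hc hf using hf
  refine ⟨∑ i ∈ s, P i, Polynomial.mem_degreeLE.mp <| Submodule.sum_mem _ fun i _ =>
    Polynomial.mem_degreeLE.mpr (hP i), ?_, fun u => ?_⟩
  · simp [Polynomial.finsetSum_coeff, hc]
  · simp [Polynomial.eval_finsetSum, hf]

theorem HasLead.id_mul {n : ℕ} {c : ℂ} {f : ℂ → ℂ} (hf : HasLead n c f) :
    HasLead (n + 1) c fun u => u * f u := by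
  obtain ⟨P, hP, hc, hf⟩ := hf
  refine ⟨Polynomial.X * P, ?_, by simp [Polynomial.coeff_X_mul, hc], fun u => by simp [hf]⟩
  rw [Polynomial.degree_le_iff_coeff_zero] at hP ⊢
  rintro (_ | m) hm
  · simp
  · rw [Polynomial.coeff_X_mul]
    exact hP m (by exact_mod_cast Nat.lt_of_succ_lt_succ (by exact_mod_cast hm))

theorem HasLead.succ {n : ℕ} {c : ℂ} {f : ℂ → ℂ} (hf : HasLead n c f) : HasLead (n + 1) 0 f := by
  obtain ⟨P, hP, -, hf⟩ := hf
  refine ⟨P, hP.trans (by exact_mod_cast n.le_succ), ?_, hf⟩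
  rw [Polynomial.degree_le_iff_coeff_zero] at hP
  exact hP _ (by exact_mod_cast n.lt_succ_self)

/-- Two polynomial functions of degree at most `N` with the same leading coefficient agree as soon as
they agree at `N` points. -/
theorem HasLead.ext {N : ℕ} {c : ℂ} {f g : ℂ → ℂ} (hf : HasLead N c f) (hg : HasLead N c g)
    {z : Fin N → ℂ} (hz : Function.Injective z) (h : ∀ n, f (z n) = g (z n)) : f = g := by
  obtain ⟨P, hP, hc, hf⟩ := hf
  obtain ⟨Q, hQ, hd, hg⟩ := hg
  have : P = Q := by
    refine Polynomial.eq_of_degree_sub_lt_of_eval_index_eq Finset.univ hz.injOn ?_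
      fun n _ => by rw [← hf, ← hg, h]
    rw [Finset.card_univ, Fintype.card_fin]
    refine lt_of_le_of_ne ((Polynomial.degree_sub_le _ _).trans (max_le hP hQ)) fun hdeg => ?_
    exact Polynomial.coeff_ne_zero_of_eq_degree hdeg (by simp [hc, hd])
  funext u
  rw [hf, hg, this]

end Leading

/-! ### The polynomial form of the transfer matrix and of its eigenvalues -/

section Transfer

variable {N : ℕ}

theorem hasLead_chain (η : ℂ) (ξ : Fin N → ℂ) (l : List (Fin N)) (i j : Fin 2)
    (s s' : Config N) :
    HasLead l.length (if i = j ∧ s = s' then 1 else 0) fun u => chain η ξ l u i j s s' := by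
  induction l generalizing i j s s' with
  | nil =>
    refine ⟨Polynomial.C (if i = j ∧ s = s' then 1 else 0), Polynomial.degree_C_le,
      Polynomial.coeff_C_zero, fun u => ?_⟩
    rw [Polynomial.eval_C]
    change (chain η ξ [] u) i j s s' = _
    rw [chain_nil]
    by_cases hij : i = j <;> simp [Matrix.one_apply, hij]
  | cons n l ih =>
    -- the factor of site `n` is linear in `u`, with leading coefficient `1`
    have split : ∀ u, rAux η (u - ξ n) n = u • 1 + rAux η (-ξ n) n := fun u => by
      rw [rAux_eq, rAux_eq, ← map_one (siteHom n).mapMatrix, ← map_smul, ← map_add]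
      congr 1
      ext i j : 1
      rw [Matrix.add_apply, Matrix.smul_apply, rBlock_apply, rBlock_apply, Matrix.one_apply]
      by_cases hij : i = j
      · simp only [hij, if_true]; module
      · simp only [hij, if_false]; module
    have h1 := (ih i j s s').id_mul
    have h2 := HasLead.sum Finset.univ fun p => HasLead.sum Finset.univ fun r =>
      ((ih p j r s').const_mul (rAux η (-ξ n) n i p s r)).succ
    convert h1.add h2 using 1
    · simp
    · simp
    · funext u
      rw [chain_cons, split, add_mul, smul_mul_assoc, one_mul]
      simp [Matrix.mul_apply]

/-- All matrix elements of `T(u)` are polynomials of degree at most `N`, with the leading coefficient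
of `tr K · u^N`. -/
theorem hasLead_transfer (K : Matrix (Fin 2) (Fin 2) ℂ) (η : ℂ) (ξ : Fin N → ℂ)
    (w v : Config N → ℂ) :
    HasLead N (K.trace * (w ⬝ᵥ v)) fun u => w ⬝ᵥ (transfer K η ξ u *ᵥ v) := by
  have h := HasLead.sum Finset.univ fun s => HasLead.sum Finset.univ fun s' =>
    (HasLead.sum Finset.univ fun i => HasLead.sum Finset.univ fun j =>
      (hasLead_chain η ξ (sites N) j i s s').const_mul (K i j)).const_mul (w s * v s')
  have hlen : (sites N).length = N := by simp [sites]
  rw [hlen] at h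
  convert h using 1
  · have h1 : ∀ s s' : Config N, ∑ i, ∑ j, K i j * (if j = i ∧ s = s' then 1 else 0) =
        if s = s' then K.trace else 0 := by
      intro s s'
      split_ifs with hs <;> simp [hs, Matrix.trace]
    simp only [h1]
    simp [dotProduct, Finset.mul_sum, mul_comm]
  · funext u
    rw [transfer, monodromy_eq, trace_scalarAux_mul]
    simp only [dotProduct, mulVec, Finset.mul_sum, Matrix.sum_apply, Matrix.smul_apply, smul_eq_mul,
      Finset.sum_mul]
    refine Finset.sum_congr rfl fun s _ => Finset.sum_congr rfl fun s' _ =>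
      Finset.sum_congr rfl fun i _ => Finset.sum_congr rfl fun j _ => ?_
    ring

theorem gFun_eq (ξ : Fin N → ℂ) (a : Fin N) (u : ℂ) :
    gFun ξ a u = (Lagrange.basis Finset.univ ξ a).eval u := by
  simp only [gFun, Lagrange.basis, Lagrange.basisDivisor, Polynomial.eval_prod]
  refine Finset.prod_congr rfl fun b _ => ?_
  simp [div_eq_inv_mul]

theorem hasLead_tPoly (K : Matrix (Fin 2) (Fin 2) ℂ) {ξ : Fin N → ℂ} (hξ : Function.Injective ξ)
    (x : Fin N → ℂ) : HasLead N K.trace (tPoly K ξ x) := by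
  have h1 : HasLead N 1 fun u => ∏ a, (u - ξ a) := by
    refine ⟨Lagrange.nodal Finset.univ ξ, by simp [Lagrange.degree_nodal], ?_, fun u => ?_⟩
    · have := Lagrange.nodal_monic (s := Finset.univ) (v := ξ)
      rw [Polynomial.Monic, Polynomial.leadingCoeff, Lagrange.natDegree_nodal] at this
      simpa using this
    · rw [Lagrange.eval_nodal]
  have h2 : ∀ a, HasLead N 0 (gFun ξ a) := fun a => by
    have hd := Lagrange.degree_basis hξ.injOn (Finset.mem_univ a)
    have hN : 0 < N := a.pos
    have : (Lagrange.basis Finset.univ ξ a).degree < (N : WithBot ℕ) := by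
      rw [hd, Finset.card_univ, Fintype.card_fin]
      exact_mod_cast Nat.sub_lt hN one_pos
    exact ⟨_, this.le, Polynomial.coeff_eq_zero_of_degree_lt this, gFun_eq ξ a⟩
  have h := (h1.const_mul K.trace).add (HasLead.sum Finset.univ fun a => (h2 a).const_mul (x a))
  convert h using 1
  · simp
  · funext u
    simp only [tPoly, mul_comm]

theorem tPoly_apply_node (K : Matrix (Fin 2) (Fin 2) ℂ) {ξ : Fin N → ℂ}
    (hξ : Function.Injective ξ) (x : Fin N → ℂ) (n : Fin N) : tPoly K ξ x (ξ n) = x n := by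
  rw [tPoly, Finset.prod_eq_zero (Finset.mem_univ n) (sub_self _), mul_zero, zero_add,
    Finset.sum_eq_single n]
  · rw [gFun_eq, Lagrange.eval_basis_self hξ.injOn (Finset.mem_univ n), one_mul]
  · intro a _ ha
    rw [gFun_eq, Lagrange.eval_basis_of_ne ha (Finset.mem_univ n), zero_mul]
  · simp

theorem mem_quadraticSolutions_iff (K : Matrix (Fin 2) (Fin 2) ℂ) (η : ℂ) (ξ : Fin N → ℂ)
    (x : Fin N → ℂ) : x ∈ quadraticSolutions K η ξ ↔
      ∀ n, x n * tPoly K ξ x (ξ n - η) = aFun η ξ (ξ n) * dFun ξ (ξ n - η) * K.det := by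
  simp only [quadraticSolutions, tPoly, Set.mem_ofPred_eq, sub_right_comm _ η]

theorem InhomogeneityCondition.injective {η : ℂ} {ξ : Fin N → ℂ}
    (h : InhomogeneityCondition η ξ) : Function.Injective ξ := by
  intro a b hab
  by_contra hne
  exact h a b hne 0 (by simp) (by simpa using hab)

/-- The shifted inhomogeneities `ξₐ - hₐ η` are distinct, whatever `h ∈ {0, 1}^N`. -/
theorem InhomogeneityCondition.injective_shift {η : ℂ} {ξ : Fin N → ℂ}
    (hξ : InhomogeneityCondition η ξ) (h : Config N) :
    Function.Injective fun n => ξ n - ((h n : ℕ) : ℂ) * η := by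
  intro a b hab
  by_contra hne
  refine hξ a b hne ((h a : ℕ) - (h b : ℕ)) ?_ ?_
  · rcases Fin.exists_fin_two.mp ⟨h a, rfl⟩ with ha | ha <;>
    rcases Fin.exists_fin_two.mp ⟨h b, rfl⟩ with hb | hb <;> simp [ha, hb]
  · push_cast
    linear_combination hab

theorem InhomogeneityCondition.aFun_ne_zero {η : ℂ} (hη : η ≠ 0) {ξ : Fin N → ℂ}
    (hξ : InhomogeneityCondition η ξ) (n : Fin N) : aFun η ξ (ξ n) ≠ 0 := by
  rw [aFun, dFun, Finset.prod_ne_zero_iff]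
  intro b _ h
  by_cases hb : n = b
  · subst hb; exact hη (by linear_combination h)
  · exact hξ n b hb (-1) (by simp) (by push_cast; linear_combination h)

theorem InhomogeneityCondition.dFun_ne_zero {η : ℂ} (hη : η ≠ 0) {ξ : Fin N → ℂ}
    (hξ : InhomogeneityCondition η ξ) (n : Fin N) : dFun ξ (ξ n - η) ≠ 0 := by
  rw [dFun, Finset.prod_ne_zero_iff]
  intro b _ h
  by_cases hb : n = b
  · subst hb; exact hη (by linear_combination -h)
  · exact hξ n b hb 1 (by simp) (by push_cast; linear_combination h)

/-- The fusion relation and the polynomial form of `T(u)` force the form of every eigenvalue. -/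
theorem exists_quadraticSolution {K : Matrix (Fin 2) (Fin 2) ℂ} {η : ℂ} {ξ : Fin N → ℂ}
    (hξ : InhomogeneityCondition η ξ) {t : ℂ → ℂ} (ht : t ∈ spectrumOf (transfer K η ξ)) :
    (fun n => t (ξ n)) ∈ quadraticSolutions K η ξ ∧ t = tPoly K ξ fun n => t (ξ n) := by
  obtain ⟨v, hv, h⟩ := ht
  obtain ⟨s, hs⟩ := Function.ne_iff.mp hv
  have hpoly : t = tPoly K ξ fun n => t (ξ n) := by
    -- pairing `T(u) v = t(u) v` with a covector that is `1` on `v` exhibits `t` as a polynomial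
    have h1 := hasLead_transfer K η ξ (Pi.single s (v s)⁻¹) v
    have h2 : (Pi.single s (v s)⁻¹ : Config N → ℂ) ⬝ᵥ v = 1 := by
      rw [single_dotProduct, inv_mul_cancel₀ hs]
    simp only [h _, dotProduct_smul, h2, smul_eq_mul, mul_one] at h1
    exact h1.ext (hasLead_tPoly K hξ.injective _) hξ.injective fun n =>
      (tPoly_apply_node K hξ.injective (fun n => t (ξ n)) n).symm
  refine ⟨(mem_quadraticSolutions_iff K η ξ _).mpr fun n => ?_, hpoly⟩
  rw [← hpoly]
  have h3 := congrArg (· *ᵥ v) (transfer_mul_transfer K η ξ n)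
  simp only [← mulVec_mulVec, h _, mulVec_smul, smul_mulVec, one_mulVec, smul_smul] at h3
  have h4 := congrFun h3 s
  simp only [Pi.smul_apply, smul_eq_mul] at h4
  rw [mul_comm]
  exact mul_right_cancel₀ hs h4

end Transfer

/-! ### Eigenvectors from an SoV basis -/

section Covectors

variable {N : ℕ}

/-- Changing one factor of an ordered product by an element that commutes with all the factors
changes the product by that element. -/
theorem prod_map_update {R ι : Type*} [Monoid R] {l : List ι} (hl : l.Nodup) {n : ι} (hn : n ∈ l)
    {f g : ι → R} {x : R} (hne : ∀ m, m ≠ n → g m = f m) (hg : g n = f n * x)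
    (hx : ∀ m, Commute x (f m)) : (l.map g).prod = (l.map f).prod * x := by
  induction l with
  | nil => simp at hn
  | cons m l ih =>
    obtain ⟨hm, hl⟩ := List.nodup_cons.mp hl
    rw [List.map_cons, List.map_cons, List.prod_cons, List.prod_cons]
    rcases List.mem_cons.mp hn with rfl | hn
    · have h1 : l.map g = l.map f := List.map_congr_left fun k hk => hne k fun e => hm (e ▸ hk)
      have h2 : Commute x (l.map f).prod := Commute.list_prod_right _ _ fun y hy => by
        obtain ⟨k, -, rfl⟩ := List.mem_map.mp hy
        exact hx k
      rw [h1, hg, mul_assoc, h2.eq, mul_assoc]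
    · rw [hne m fun e => hm (e ▸ hn), ih hl hn, mul_assoc]

/-- Applying `T(ξₙ)` to `⟨h|` with `hₙ = 0` sets `hₙ` to `1`, since the factors of the product
commute. -/
theorem sovCovector_update (K : Matrix (Fin 2) (Fin 2) ℂ) {η : ℂ} (hη : η ≠ 0) (ξ : Fin N → ℂ)
    (S : Config N → ℂ) {h : Config N} {n : Fin N} (hn : h n = 0) :
    sovCovector K η ξ S (Function.update h n 1) =
      (aFun η ξ (ξ n))⁻¹ • (sovCovector K η ξ S h ᵥ* transfer K η ξ (ξ n)) := by
  rw [sovCovector, sovCovector, ← vecMul_smul, vecMul_vecMul, List.ofFn_eq_map, List.ofFn_eq_map]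
  congr 1
  refine prod_map_update (List.nodup_finRange N) (List.mem_finRange n) ?_ ?_ ?_
  · intro m hm
    rw [Function.update_of_ne hm]
  · simp [hn]
  · intro m
    exact (((transfer_commute K hη ξ _ _).smul_left _).smul_right _).pow_right _

theorem isUnit_sov {K : Matrix (Fin 2) (Fin 2) ℂ} {η : ℂ} {ξ : Fin N → ℂ} {S : Config N → ℂ}
    (hS : IsSoVBasis K η ξ S) : IsUnit (Matrix.of (sovCovector K η ξ S)) :=
  Matrix.linearIndependent_rows_iff_isUnit.mp hS.1

theorem list_prod_mulVec {ι m : Type*} [Fintype m] [DecidableEq m] (l : List ι)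
    (f : ι → Matrix m m ℂ) (c : ι → ℂ) (v : m → ℂ) (h : ∀ i, f i *ᵥ v = c i • v) :
    (l.map f).prod *ᵥ v = (l.map c).prod • v := by
  induction l with
  | nil => simp
  | cons i l ih => simp [← mulVec_mulVec, ih, mulVec_smul, h, smul_smul, mul_comm]

/-- In every SoV basis the wave function of an eigenvector factorizes. -/
theorem sovCovector_dotProduct {K : Matrix (Fin 2) (Fin 2) ℂ} {η : ℂ} {ξ : Fin N → ℂ}
    (S : Config N → ℂ) {t : ℂ → ℂ} {w : Config N → ℂ} (hw : IsJointEigen (transfer K η ξ) t w)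
    (h : Config N) : sovCovector K η ξ S h ⬝ᵥ w =
      (∏ n, (t (ξ n) / aFun η ξ (ξ n)) ^ (h n : ℕ)) * (S ⬝ᵥ w) := by
  rw [sovCovector, ← dotProduct_mulVec, List.ofFn_eq_map, list_prod_mulVec (c := fun n =>
    (t (ξ n) / aFun η ξ (ξ n)) ^ (h n : ℕ)), dotProduct_smul, smul_eq_mul, ← List.ofFn_eq_map,
    List.prod_ofFn]
  intro n
  rcases Fin.exists_fin_two.mp ⟨h n, rfl⟩ with hn | hn <;>
    simp [hn, smul_mulVec, hw (ξ n), smul_smul, div_eq_inv_mul]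

/-- A solution of the quadratic system defines, by its factorized wave function, an eigenvector: both
sides of `⟨h|T(u)|v⟩ = t(u)⟨h|v⟩` have degree `N` in `u` and the same leading coefficient, and they
agree at the `N` points `ξₙ - hₙ η`. -/
theorem exists_eigenvector {K : Matrix (Fin 2) (Fin 2) ℂ} {η : ℂ} (hη : η ≠ 0) {ξ : Fin N → ℂ}
    (hξ : InhomogeneityCondition η ξ) {S : Config N → ℂ} (hS : IsSoVBasis K η ξ S)
    {x : Fin N → ℂ} (hx : x ∈ quadraticSolutions K η ξ) :
    ∃ v, IsJointEigen (transfer K η ξ) (tPoly K ξ x) v ∧ S ⬝ᵥ v = 1 := by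
  have hU := isUnit_sov hS
  set X : Op N := Matrix.of (sovCovector K η ξ S) with hX
  set ψ : Config N → ℂ := fun h => ∏ n, (x n / aFun η ξ (ξ n)) ^ (h n : ℕ) with hψ
  have hinv : X * X⁻¹ = 1 := Matrix.mul_nonsing_inv _ ((Matrix.isUnit_iff_isUnit_det _).mp hU)
  have hv : X *ᵥ (X⁻¹ *ᵥ ψ) = ψ := by rw [mulVec_mulVec, hinv, one_mulVec]
  set v := X⁻¹ *ᵥ ψ
  have hv' : ∀ h, sovCovector K η ξ S h ⬝ᵥ v = ψ h := fun h => congrFun hv h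
  have hψu : ∀ h n, h n = 0 →
      aFun η ξ (ξ n) * ψ (Function.update h n 1) = x n * ψ h := by
    intro h n hn
    have hz := hξ.aFun_ne_zero hη n
    simp only [hψ]
    rw [← Finset.mul_prod_erase _ _ (Finset.mem_univ n),
      ← Finset.mul_prod_erase _ _ (Finset.mem_univ n),
      Finset.prod_congr rfl fun m hm => by rw [Function.update_of_ne (Finset.ne_of_mem_erase hm)]]
    simp [hn]
    field_simp
  refine ⟨v, ?_, ?_⟩
  · have key : ∀ h, (fun u => sovCovector K η ξ S h ⬝ᵥ (transfer K η ξ u *ᵥ v)) =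
        fun u => ψ h * tPoly K ξ x u := by
      intro h
      have h1 := hasLead_transfer K η ξ (sovCovector K η ξ S h) v
      rw [hv', mul_comm] at h1
      refine h1.ext ((hasLead_tPoly K hξ.injective x).const_mul (ψ h)) (hξ.injective_shift h)
        fun n => ?_
      have hz := hξ.aFun_ne_zero hη n
      rcases Fin.exists_fin_two.mp ⟨h n, rfl⟩ with hn | hn
      · have h2 := sovCovector_update K hη ξ S hn
        have h3 := hv' (Function.update h n 1)
        rw [h2, smul_dotProduct, ← dotProduct_mulVec, smul_eq_mul, inv_mul_eq_iff_eq_mul₀ hz,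
          hψu h n hn] at h3
        simp [hn, h3, tPoly_apply_node K hξ.injective, mul_comm]
      · -- here `⟨h|` is obtained from `⟨h₀|`, `h₀ = update h n 0`, by `T(ξₙ)`, and the fusion relation
        -- brings `⟨h|T(ξₙ - η)` back to a multiple of `⟨h₀|`
        have h0 : Function.update h n 0 n = 0 := Function.update_self _ _ _
        have hh : Function.update (Function.update h n 0) n 1 = h := by
          rw [Function.update_idem, ← hn, Function.update_eq_self]
        have h2 := sovCovector_update K hη ξ S h0
        have h4 := hψu _ _ h0
        rw [hh] at h2 h4
        have h5 := (mem_quadraticSolutions_iff K η ξ x).mp hx n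
        have h6 : sovCovector K η ξ S h ⬝ᵥ (transfer K η ξ (ξ n - η) *ᵥ v) =
            (aFun η ξ (ξ n))⁻¹ * (aFun η ξ (ξ n) * dFun ξ (ξ n - η) * K.det *
              ψ (Function.update h n 0)) := by
          rw [h2, smul_dotProduct, dotProduct_mulVec, vecMul_vecMul, transfer_mul_transfer,
            vecMul_smul, vecMul_one, smul_dotProduct, hv', smul_eq_mul, smul_eq_mul]
        rw [hn, Fin.val_one, Nat.cast_one, one_mul]
        rw [h6, ← h5, inv_mul_eq_iff_eq_mul₀ hz]
        linear_combination -tPoly K ξ x (ξ n - η) * h4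
    intro u
    refine Matrix.mulVec_injective_iff_isUnit.mpr hU ?_
    funext h
    have := congrFun (key h) u
    rw [mulVec_smul, hv]
    simp only [Pi.smul_apply, smul_eq_mul]
    rw [mul_comm, ← this]; rfl
  · have := hv' 0
    simpa [hψ, sovCovector, List.ofFn_eq_map, List.map_const'] using this

end Covectors

/-! ### Change of basis in the auxiliary space and the weight filtration -/

section Gauge

variable {N : ℕ}

theorem mapMatrix_scalarAux {A B : Type*} [Ring A] [Algebra ℂ A] [Ring B] [Algebra ℂ B]
    (φ : A →ₐ[ℂ] B) (K : Matrix (Fin 2) (Fin 2) ℂ) :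
    φ.mapMatrix (scalarAux A K) = scalarAux B K := by
  ext i j : 1
  simp [scalarAux_apply]

/-- `Γ_a M_a Γ_a⁻¹`: the change of basis `Γ` in the auxiliary space. -/
noncomputable def gauge {A : Type*} [Ring A] [Algebra ℂ A] (Γ : Matrix (Fin 2) (Fin 2) ℂ)
    (M : Matrix (Fin 2) (Fin 2) A) : Matrix (Fin 2) (Fin 2) A :=
  scalarAux A Γ * M * scalarAux A Γ⁻¹

theorem gauge_one {A : Type*} [Ring A] [Algebra ℂ A] {Γ : Matrix (Fin 2) (Fin 2) ℂ}
    (hΓ : IsUnit Γ.det) : gauge Γ (1 : Matrix (Fin 2) (Fin 2) A) = 1 := by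
  rw [gauge, mul_one, ← map_mul, Matrix.mul_nonsing_inv _ hΓ, map_one]

theorem gauge_mul {A : Type*} [Ring A] [Algebra ℂ A] {Γ : Matrix (Fin 2) (Fin 2) ℂ}
    (hΓ : IsUnit Γ.det) (L M : Matrix (Fin 2) (Fin 2) A) :
    gauge Γ (L * M) = gauge Γ L * gauge Γ M := by
  have : scalarAux A Γ⁻¹ * scalarAux A Γ = 1 := by
    rw [← map_mul, Matrix.nonsing_inv_mul _ hΓ, map_one]
  simp only [gauge, mul_assoc]
  rw [← mul_assoc (scalarAux A Γ⁻¹) (scalarAux A Γ), this, one_mul]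

theorem EntriesCommute.gauge {A : Type*} [Ring A] [Algebra ℂ A] (Γ : Matrix (Fin 2) (Fin 2) ℂ)
    {L M : Matrix (Fin 2) (Fin 2) A} (h : EntriesCommute L M) :
    EntriesCommute (gauge Γ L) (gauge Γ M) := by
  have key : ∀ {L M : Matrix (Fin 2) (Fin 2) A}, EntriesCommute L M →
      EntriesCommute (SixVertex.gauge Γ L) M := fun h =>
    ((entriesCommute_scalarAux _ _).mul_left h).mul_left (entriesCommute_scalarAux _ _)
  exact key (key h.symm).symm

theorem RTT.gauge {A : Type*} [Ring A] [Algebra ℂ A] (Γ : Matrix (Fin 2) (Fin 2) ℂ) {η u : ℂ}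
    {M M' : Matrix (Fin 2) (Fin 2) A} (h : RTT η u M M') :
    RTT η u (gauge Γ M) (gauge Γ M') :=
  ((rtt_scalarAux η u Γ).mul h (entriesCommute_scalarAux _ _).symm
    (entriesCommute_scalarAux _ _).symm).mul (rtt_scalarAux η u Γ⁻¹)
    (entriesCommute_scalarAux _ _) (entriesCommute_scalarAux _ _)

theorem HasQDet.gauge {A : Type*} [Ring A] [Algebra ℂ A] {Γ : Matrix (Fin 2) (Fin 2) ℂ}
    (hΓ : IsUnit Γ.det) {q : ℂ} {M M' : Matrix (Fin 2) (Fin 2) A} (h : HasQDet M M' q) :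
    HasQDet (gauge Γ M) (gauge Γ M') q := by
  have := ((hasQDet_scalarAux Γ).mul h (entriesCommute_scalarAux _ _).symm).mul
    (hasQDet_scalarAux Γ⁻¹) (entriesCommute_scalarAux _ _)
  have hq : Γ.det * q * Γ⁻¹.det = q := by
    rw [mul_right_comm, ← det_mul, Matrix.mul_nonsing_inv _ hΓ, det_one, one_mul]
  rwa [hq] at this

/-- In the basis of the rows of `Γ`, the permutation operator is made of rank-one operators. -/
theorem gauge_rAux_apply {Γ : Matrix (Fin 2) (Fin 2) ℂ} (hΓ : IsUnit Γ.det) (η u : ℂ) (n : Fin N)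
    (i j : Fin 2) : gauge Γ (rAux η u n) i j =
      (if i = j then u else 0) • (1 : Op N) +
        η • siteOp n (Matrix.vecMulVec (fun k => Γ⁻¹ k j) (Γ i)) := by
  have h1 : gauge Γ (rAux η u n) = (siteHom n).mapMatrix (gauge Γ (rBlock η u)) := by
    rw [gauge, gauge, rAux_eq, map_mul, map_mul, mapMatrix_scalarAux, mapMatrix_scalarAux]
  have h2 : gauge Γ (rBlock η u) i j =
      (if i = j then u else 0) • 1 + η • Matrix.vecMulVec (fun k => Γ⁻¹ k j) (Γ i) := by
    have h3 := congrFun (congrFun (Matrix.mul_nonsing_inv _ hΓ) i) j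
    rw [Matrix.mul_apply, Fin.sum_univ_two, Matrix.one_apply] at h3
    have h4 : (if i = j then u else 0) = u * (if i = j then 1 else 0) := by simp
    rw [h4, ← h3]
    ext k l
    simp only [gauge, Matrix.mul_apply, Fin.sum_univ_two, scalarAux_apply, rBlock_apply]
    fin_cases k <;> fin_cases l <;>
      simp [vecMulVec_apply] <;> ring
  rw [h1, AlgHom.mapMatrix_apply, Matrix.map_apply, h2, map_add, map_smul, map_smul, map_one,
    siteHom_apply]

/-- The tensor product covector whose `n`-th factor is the row `hₙ` of `Γ`. -/
def rowTensor (Γ : Matrix (Fin 2) (Fin 2) ℂ) (h : Config N) : Config N → ℂ :=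
  fun s => ∏ n, Γ (h n) (s n)

theorem rowTensor_vecMul_siteOp {Γ : Matrix (Fin 2) (Fin 2) ℂ} (hΓ : IsUnit Γ.det) (n : Fin N)
    (i j : Fin 2) (h : Config N) :
    rowTensor Γ h ᵥ* siteOp n (Matrix.vecMulVec (fun k => Γ⁻¹ k j) (Γ i)) =
      if h n = j then rowTensor Γ (Function.update h n i) else 0 := by
  have h3 := congrFun (congrFun (Matrix.mul_nonsing_inv _ hΓ) (h n)) j
  rw [Matrix.mul_apply, Matrix.one_apply] at h3
  funext s
  have h4 : ∀ k, rowTensor Γ h (Function.update s n k) =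
      Γ (h n) k * ∏ m ∈ Finset.univ.erase n, Γ (h m) (s m) := fun k => by
    rw [rowTensor, ← Finset.mul_prod_erase _ _ (Finset.mem_univ n), Function.update_self,
      Finset.prod_congr rfl fun m hm => by rw [Function.update_of_ne (Finset.ne_of_mem_erase hm)]]
  have h5 : rowTensor Γ (Function.update h n i) s =
      Γ i (s n) * ∏ m ∈ Finset.univ.erase n, Γ (h m) (s m) := by
    rw [rowTensor, ← Finset.mul_prod_erase _ _ (Finset.mem_univ n), Function.update_self,
      Finset.prod_congr rfl fun m hm => by rw [Function.update_of_ne (Finset.ne_of_mem_erase hm)]]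
  have h6 : (rowTensor Γ h ᵥ* siteOp n (Matrix.vecMulVec (fun k => Γ⁻¹ k j) (Γ i))) s =
      (if h n = j then 1 else 0) * rowTensor Γ (Function.update h n i) s := by
    rw [vecMul_siteOp, ← h3, h5, Finset.sum_mul]
    refine Finset.sum_congr rfl fun k _ => ?_
    rw [h4, vecMulVec_apply]
    ring
  rw [h6]
  split_ifs <;> simp

/-- On tensor products of rows of `Γ`, the factor of site `n` acts on the labels `h` as it does in the
canonical basis. -/
theorem rowTensor_vecMul_gauge {Γ : Matrix (Fin 2) (Fin 2) ℂ} (hΓ : IsUnit Γ.det) (η u : ℂ)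
    (n : Fin N) (i j : Fin 2) (h : Config N) :
    rowTensor Γ h ᵥ* gauge Γ (rAux η u n) i j =
      (if i = j then u else 0) • rowTensor Γ h +
        η • if h n = j then rowTensor Γ (Function.update h n i) else 0 := by
  rw [gauge_rAux_apply hΓ, vecMul_add, vecMul_smul, vecMul_one, vecMul_smul,
    rowTensor_vecMul_siteOp hΓ]

/-- The number of sites in state `1`. -/
def weight (h : Config N) : ℕ := ∑ n, (h n : ℕ)

theorem weight_update (h : Config N) (n : Fin N) (i : Fin 2) :
    weight (Function.update h n i) + (h n : ℕ) = weight h + (i : ℕ) := by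
  rw [weight, weight, ← Finset.add_sum_erase _ _ (Finset.mem_univ n),
    ← Finset.add_sum_erase _ (fun m => (h m : ℕ)) (Finset.mem_univ n), Function.update_self,
    Finset.sum_congr rfl fun m hm => by rw [Function.update_of_ne (Finset.ne_of_mem_erase hm)]]
  omega

/-- The span of the tensor product covectors of weight less than `k`. -/
def weightFiltration (Γ : Matrix (Fin 2) (Fin 2) ℂ) (N k : ℕ) : Submodule ℂ (Config N → ℂ) :=
  Submodule.span ℂ (Set.range fun h : {h : Config N // weight h < k} => rowTensor Γ h.1)

theorem rowTensor_mem_weightFiltration (Γ : Matrix (Fin 2) (Fin 2) ℂ) {h : Config N} {k : ℕ}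
    (hk : weight h < k) : rowTensor Γ h ∈ weightFiltration Γ N k :=
  Submodule.subset_span ⟨⟨h, hk⟩, rfl⟩

theorem weightFiltration_mono (Γ : Matrix (Fin 2) (Fin 2) ℂ) (N : ℕ) :
    Monotone (weightFiltration Γ N) := fun k l hkl =>
  Submodule.span_le.mpr (by
    rintro _ ⟨h, rfl⟩
    exact rowTensor_mem_weightFiltration Γ (h.2.trans_le hkl))

theorem weightFiltration_zero (Γ : Matrix (Fin 2) (Fin 2) ℂ) (N : ℕ) :
    weightFiltration Γ N 0 = ⊥ := by
  rw [weightFiltration, Submodule.span_eq_bot]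
  rintro _ ⟨h, rfl⟩
  exact absurd h.2 (Nat.not_lt_zero _)

/-- The entry `(i, j)` of the gauged monodromy matrix raises the weight by `i - j`. -/
theorem vecMul_gauge_chain_mem {Γ : Matrix (Fin 2) (Fin 2) ℂ} (hΓ : IsUnit Γ.det) (η : ℂ)
    (ξ : Fin N → ℂ) {l : List (Fin N)} (hl : l.Nodup) (u : ℂ) (i j : Fin 2) (k : ℕ) {v : Config N → ℂ}
    (hv : v ∈ weightFiltration Γ N (k + j)) :
    v ᵥ* gauge Γ (chain η ξ l u) i j ∈ weightFiltration Γ N (k + i) := by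
  induction l generalizing i j v with
  | nil =>
    rw [chain_nil, gauge_one hΓ, Matrix.one_apply]
    split_ifs with hij
    · rwa [vecMul_one, hij]
    · rw [vecMul_zero]; exact zero_mem _
  | cons n l ih =>
    have single : ∀ (i j : Fin 2) {v : Config N → ℂ}, v ∈ weightFiltration Γ N (k + j) →
        v ᵥ* gauge Γ (rAux η (u - ξ n) n) i j ∈ weightFiltration Γ N (k + i) := by
      intro i j v hv
      refine Submodule.span_le (p := (weightFiltration Γ N (k + i)).comap
        (Matrix.vecMulLinear (gauge Γ (rAux η (u - ξ n) n) i j))) |>.mpr ?_ hv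
      rintro _ ⟨⟨h, hh⟩, rfl⟩
      simp only [SetLike.mem_coe, Submodule.mem_comap, Matrix.vecMulLinear_apply]
      rw [rowTensor_vecMul_gauge hΓ]
      refine add_mem ?_ (Submodule.smul_mem _ _ ?_)
      · split_ifs with hij
        · exact Submodule.smul_mem _ _ (rowTensor_mem_weightFiltration Γ (hij ▸ hh))
        · rw [zero_smul]; exact zero_mem _
      · split_ifs with hn
        · refine rowTensor_mem_weightFiltration Γ ?_
          have := weight_update h n i
          rw [hn] at this
          omega
        · exact zero_mem _
    obtain ⟨hn, hl⟩ := List.nodup_cons.mp hl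
    have hcomm := (entriesCommute_chain_rAux η ξ hn u (u - ξ n)).gauge Γ
    rw [chain_cons, gauge_mul hΓ, Matrix.mul_apply, Fin.sum_univ_two, vecMul_add,
      ← (hcomm _ _ _ _).eq, ← (hcomm _ _ _ _).eq, ← vecMul_vecMul, ← vecMul_vecMul]
    exact add_mem (single i 0 (ih hl 0 j hv)) (single i 1 (ih hl 1 j hv))

/-- The reference covector `s ⊗ ⋯ ⊗ s`, for `s` the first row of `Γ`, is annihilated by the entry
`(0, 1)`, which would lower the weight, and is an eigenvector of the entry `(1, 1)`. -/
theorem rowTensor_zero_vecMul_gauge_chain {Γ : Matrix (Fin 2) (Fin 2) ℂ} (hΓ : IsUnit Γ.det)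
    (η : ℂ) (ξ : Fin N → ℂ) {l : List (Fin N)} (hl : l.Nodup) (u : ℂ) :
    rowTensor Γ (0 : Config N) ᵥ* gauge Γ (chain η ξ l u) 1 1 =
      (l.map fun n => u - ξ n).prod • rowTensor Γ (0 : Config N) := by
  induction l with
  | nil => simp [gauge_one hΓ]
  | cons n l ih =>
    obtain ⟨hn, hl⟩ := List.nodup_cons.mp hl
    have hcomm := (entriesCommute_chain_rAux η ξ hn u (u - ξ n)).gauge Γ
    have h01 : rowTensor Γ (0 : Config N) ᵥ* gauge Γ (chain η ξ l u) 0 1 = 0 := by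
      have := vecMul_gauge_chain_mem hΓ η ξ hl u 0 1 0
        (rowTensor_mem_weightFiltration Γ (h := (0 : Config N)) (by simp [weight]))
      simpa [weightFiltration_zero] using this
    have h11 : rowTensor Γ (0 : Config N) ᵥ* gauge Γ (rAux η (u - ξ n) n) 1 1 =
        (u - ξ n) • rowTensor Γ (0 : Config N) := by
      rw [rowTensor_vecMul_gauge hΓ]
      simp
    rw [chain_cons, gauge_mul hΓ, Matrix.mul_apply, Fin.sum_univ_two, vecMul_add,
      ← (hcomm _ _ _ _).eq, ← vecMul_vecMul, ← vecMul_vecMul, h01, zero_vecMul, zero_add, h11,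
      smul_vecMul, ih hl, smul_smul, List.map_cons, List.prod_cons]

end Gauge

/-! ### Eigenvectors of the entry `D` of the monodromy matrix -/

section Sklyanin

variable {N : ℕ}

/-- One step of Sklyanin's construction: the operator `C(ξₙ)` turns an eigenvector of `D(u)` whose
eigenvalue vanishes at `u = ξₙ` into an eigenvector with the zero moved to `ξₙ - η`. The new vector is
nonzero because `C(ξₙ) B(ξₙ - η)` acts on the old one as minus the quantum determinant. -/
theorem eigen_step {M : ℂ → Matrix (Fin 2) (Fin 2) (Op N)} {η q z : ℂ} (hq : q ≠ 0)
    (hcont : ∀ i j, Continuous fun u => M u i j) (hM : ∀ u w, RTT η (u - w) (M u) (M w))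
    (hdet : HasQDet (M z) (M (z - η)) q) {v : Config N → ℂ} (hv : v ≠ 0) {e : ℂ → ℂ}
    (he : Continuous e) (hD : ∀ u, v ᵥ* M u 1 1 = ((u - z) * e u) • v) :
    v ᵥ* M z 1 0 ≠ 0 ∧
      ∀ u, (v ᵥ* M z 1 0) ᵥ* M u 1 1 = ((u - z + η) * e u) • (v ᵥ* M z 1 0) := by
  have hz : v ᵥ* M z 1 1 = 0 := by rw [hD, sub_self, zero_mul, zero_smul]
  constructor
  · intro h0
    have h1 := congrArg (v ᵥ* ·) (hdet 1 0)
    simp only [vecMul_sub, ← vecMul_vecMul, h0, hz, zero_vecMul, sub_zero, vecMul_smul,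
      vecMul_one] at h1
    simp [levi, hq, hv] at h1
  · -- the RTT relation gives the eigenvalue for `u ≠ z` only; `u = z` follows by continuity
    have hne : Set.EqOn (fun u => (v ᵥ* M z 1 0) ᵥ* M u 1 1)
        (fun u => ((u - z + η) * e u) • (v ᵥ* M z 1 0)) {z}ᶜ := by
      intro u hu
      have hu' : u - z ≠ 0 := sub_ne_zero.mpr hu
      have h1 := congrArg (v ᵥ* ·) (hM u z 1 1 1 0)
      simp only [vecMul_add, vecMul_smul, ← vecMul_vecMul, hD u, hz, zero_vecMul, smul_vecMul,
        smul_zero, add_zero] at h1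
      refine smul_right_injective _ hu' ?_
      dsimp only
      rw [← h1]
      module
    have := Continuous.ext_on (dense_compl_singleton z)
      (Continuous.matrix_vecMul continuous_const (hcont 1 1)) (by fun_prop) hne
    exact congrFun this

theorem continuous_chain (η : ℂ) (ξ : Fin N → ℂ) (l : List (Fin N)) (i j : Fin 2) :
    Continuous fun u => chain η ξ l u i j := by
  refine continuous_matrix fun s s' => ?_
  obtain ⟨P, -, -, h⟩ := hasLead_chain η ξ l i j s s'
  have : (fun u => chain η ξ l u i j s s') = fun u => P.eval u := funext h
  rw [this]
  exact P.continuous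

theorem continuous_gauge {M : ℂ → Matrix (Fin 2) (Fin 2) (Op N)} (Γ : Matrix (Fin 2) (Fin 2) ℂ)
    (hcont : ∀ i j, Continuous fun u => M u i j) (i j : Fin 2) :
    Continuous fun u => gauge Γ (M u) i j := by
  simp only [gauge, Matrix.mul_apply, Fin.sum_univ_two, scalarAux_apply]
  have h00 := hcont 0 0
  have h01 := hcont 0 1
  have h10 := hcont 1 0
  have h11 := hcont 1 1
  fun_prop

/-- The sites in state `1`. -/
def support (h : Config N) : List (Fin N) := (List.finRange N).filter (h · = 1)

theorem nodup_support (h : Config N) : (support h).Nodup := (List.nodup_finRange N).filter _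

theorem mem_support (h : Config N) (n : Fin N) : n ∈ support h ↔ h n = 1 := by
  simp [support]

theorem length_support (h : Config N) : (support h).length = weight h := by
  have : ∀ l : List (Fin N), (l.filter (h · = 1)).length = (l.map fun n => (h n : ℕ)).sum := by
    intro l
    induction l with
    | nil => rfl
    | cons n l ih =>
      rcases Fin.exists_fin_two.mp ⟨h n, rfl⟩ with hn | hn <;>
        simp [hn, ih, add_comm]
  rw [support, this, ← List.ofFn_eq_map, List.sum_ofFn, weight]

theorem prod_map_smul_pow (c : Fin N → ℂ) (f : Fin N → Op N) (h : Config N)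
    (l : List (Fin N)) : (l.map fun n => (c n • f n) ^ (h n : ℕ)).prod =
      ((l.filter (h · = 1)).map c).prod • ((l.filter (h · = 1)).map f).prod := by
  induction l with
  | nil => simp
  | cons n l ih =>
    rcases Fin.exists_fin_two.mp ⟨h n, rfl⟩ with hn | hn <;>
      simp [hn, ih, smul_smul, mul_comm]

theorem vecMul_list_prod {ι m : Type*} [Fintype m] [DecidableEq m] (l : List ι)
    (f : ι → Matrix m m ℂ) (c : ι → ℂ) (v : m → ℂ) (h : ∀ i, v ᵥ* f i = c i • v) :
    v ᵥ* (l.map f).prod = (l.map c).prod • v := by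
  induction l with
  | nil => simp
  | cons i l ih => simp [← vecMul_vecMul, h, smul_vecMul, ih, smul_smul]

/-- The products `⟨0| ∏ C(ξₙ)` over lists of distinct sites are eigenvectors of `D(u)`. -/
theorem eigen_list {M : ℂ → Matrix (Fin 2) (Fin 2) (Op N)} {η : ℂ} {ξ : Fin N → ℂ} {q : Fin N → ℂ}
    (hq : ∀ n, q n ≠ 0) (hcont : ∀ i j, Continuous fun u => M u i j)
    (hM : ∀ u w, RTT η (u - w) (M u) (M w))
    (hdet : ∀ n, HasQDet (M (ξ n)) (M (ξ n - η)) (q n)) {S : Config N → ℂ} (hS : S ≠ 0)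
    (hD : ∀ u, S ᵥ* M u 1 1 = (∏ n, (u - ξ n)) • S) {l : List (Fin N)} (hl : l.Nodup) :
    S ᵥ* (l.map fun n => M (ξ n) 1 0).prod ≠ 0 ∧
      ∀ u, (S ᵥ* (l.map fun n => M (ξ n) 1 0).prod) ᵥ* M u 1 1 =
        (∏ m, (u - ξ m + if m ∈ l then η else 0)) • (S ᵥ* (l.map fun n => M (ξ n) 1 0).prod) := by
  induction l using List.reverseRecOn with
  | nil => simpa using ⟨hS, hD⟩
  | append_singleton l n ih =>
    have hn : n ∉ l := fun h => (List.nodup_append.mp hl).2.2 n h n (by simp) rfl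
    obtain ⟨h1, h2⟩ := ih (List.nodup_append.mp hl).1
    have h3 := eigen_step (hq n) hcont hM (hdet n) h1
      (e := fun u => ∏ m ∈ Finset.univ.erase n, (u - ξ m + if m ∈ l then η else 0))
      (by fun_prop) (fun u => by
        rw [h2, ← Finset.mul_prod_erase _ _ (Finset.mem_univ n), if_neg hn, add_zero])
    rw [List.map_append, List.prod_append, ← vecMul_vecMul]
    simp only [List.map_cons, List.map_nil, List.prod_cons, List.prod_nil, mul_one]
    refine ⟨h3.1, fun u => ?_⟩
    rw [h3.2, ← Finset.mul_prod_erase _ _ (Finset.mem_univ n)]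
    congr 2
    · simp
    · refine Finset.prod_congr rfl fun m hm => ?_
      simp [Finset.ne_of_mem_erase hm]

/-- The eigenvectors of `D(u)` are linearly independent: a product of `D`'s at suitable points kills
all of them but one. -/
theorem linearIndependent_of_eigen {D : ℂ → Op N} {η : ℂ} (hη : η ≠ 0) {ξ : Fin N → ℂ}
    (hξ : InhomogeneityCondition η ξ) {w : Config N → Config N → ℂ} (hw : ∀ h, w h ≠ 0)
    (hD : ∀ h u, w h ᵥ* D u = (∏ m, (u - ξ m + if h m = 1 then η else 0)) • w h) :
    LinearIndependent ℂ w := by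
  rw [Fintype.linearIndependent_iff]
  intro g hg h
  -- at `u = ξₙ` the eigenvalue of `w h'` vanishes if `h' n = 0`, at `u = ξₙ - η` if `h' n = 1`, so
  -- `E` kills every `w h'` with `h' ≠ h`
  set E : Op N := ((List.finRange N).map fun n => D (ξ n - if h n = 1 then 0 else η)).prod with hE
  have hEw : ∀ h', w h' ᵥ* E = (∏ n, ∏ m, (ξ n - (if h n = 1 then 0 else η) - ξ m +
      if h' m = 1 then η else 0)) • w h' := fun h' => by
    rw [hE, vecMul_list_prod _ _ _ _ fun n => hD h' _, ← List.ofFn_eq_map, List.prod_ofFn]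
  have h1 := congrArg (· ᵥ* E) hg
  simp only [zero_vecMul] at h1
  rw [← Matrix.vecMulLinear_apply, map_sum, Finset.sum_eq_single h] at h1
  · rw [map_smul, Matrix.vecMulLinear_apply, hEw, smul_smul] at h1
    refine (mul_eq_zero.mp ((smul_eq_zero.mp h1).resolve_right (hw h))).resolve_right ?_
    simp only [Finset.prod_ne_zero_iff]
    intro n _ m _ h0
    by_cases hnm : n = m
    · subst hnm
      split_ifs at h0
      · exact hη (by linear_combination h0)
      · exact hη (by linear_combination -h0)
    · split_ifs at h0
      · exact hξ n m hnm (-1) (by simp) (by push_cast; linear_combination h0)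
      · exact hξ n m hnm 0 (by simp) (by push_cast; linear_combination h0)
      · exact hξ n m hnm 0 (by simp) (by push_cast; linear_combination h0)
      · exact hξ n m hnm 1 (by simp) (by push_cast; linear_combination h0)
  · intro h' _ hne
    obtain ⟨n, hn⟩ := Function.ne_iff.mp hne
    have h0 : (ξ n - (if h n = 1 then 0 else η) - ξ n + if h' n = 1 then η else 0) = 0 := by
      rcases Fin.exists_fin_two.mp ⟨h n, rfl⟩ with h2 | h2 <;>
        rcases Fin.exists_fin_two.mp ⟨h' n, rfl⟩ with h3 | h3 <;> simp_all
    rw [map_smul, Matrix.vecMulLinear_apply, hEw]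
    rw [Finset.prod_eq_zero (Finset.mem_univ n) (Finset.prod_eq_zero (Finset.mem_univ n) h0),
      zero_smul, smul_zero]
  · simp

/-- The leading part of `⟨0| ∏ T(ξₙ)` in the weight filtration is `⟨0| ∏ C(ξₙ)`, if
`T = C + b B + d D`. -/
theorem sub_mem_weightFiltration {Γ : Matrix (Fin 2) (Fin 2) ℂ}
    {M : ℂ → Matrix (Fin 2) (Fin 2) (Op N)}
    (hM : ∀ u i j k v, v ∈ weightFiltration Γ N (k + (j : Fin 2)) →
      v ᵥ* M u i j ∈ weightFiltration Γ N (k + (i : Fin 2)))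
    {T : ℂ → Op N} {b d : ℂ} (hT : ∀ u, T u = M u 1 0 + b • M u 0 1 + d • M u 1 1)
    {S : Config N → ℂ} (hS : S ∈ weightFiltration Γ N 1) (ξ : Fin N → ℂ) (l : List (Fin N)) :
    S ᵥ* (l.map fun n => M (ξ n) 1 0).prod ∈ weightFiltration Γ N (l.length + 1) ∧
      S ᵥ* (l.map fun n => T (ξ n)).prod - S ᵥ* (l.map fun n => M (ξ n) 1 0).prod ∈
        weightFiltration Γ N l.length := by
  induction l using List.reverseRecOn with
  | nil => simpa using hS
  | append_singleton l n ih =>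
    obtain ⟨h1, h2⟩ := ih
    simp only [List.map_append, List.prod_append, List.map_cons, List.map_nil, List.prod_cons,
      List.prod_nil, mul_one, ← vecMul_vecMul, List.length_append, List.length_cons,
      List.length_nil, zero_add]
    set v := S ᵥ* (l.map fun n => M (ξ n) 1 0).prod
    set w := S ᵥ* (l.map fun n => T (ξ n)).prod
    refine ⟨hM _ 1 0 _ _ h1, ?_⟩
    have e : w ᵥ* T (ξ n) - v ᵥ* M (ξ n) 1 0 = (w - v) ᵥ* M (ξ n) 1 0 +
        (b • (w ᵥ* M (ξ n) 0 1) + d • (w ᵥ* M (ξ n) 1 1)) := by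
      rw [hT, vecMul_add, vecMul_add, vecMul_smul, vecMul_smul, sub_vecMul]
      abel
    have hw : w ∈ weightFiltration Γ N (l.length + 1) := by
      rw [← sub_add_cancel w v]
      exact add_mem (weightFiltration_mono Γ N l.length.le_succ h2) h1
    rw [e]
    exact add_mem (hM _ 1 0 _ _ h2) (add_mem
      (Submodule.smul_mem _ _ (weightFiltration_mono Γ N l.length.le_succ (hM _ 0 1 _ _ hw)))
      (Submodule.smul_mem _ _ (hM _ 1 1 _ _ hw)))

end Sklyanin

/-! ### The SoV basis generated by a tensor product covector -/

section Basis

variable {N : ℕ}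

/-- For a linearly independent family adapted to the weight filtration and a second family that
agrees with it up to lower weight, the second one spans. -/
theorem span_eq_top_of_triangular {Γ : Matrix (Fin 2) (Fin 2) ℂ} {v w : Config N → Config N → ℂ}
    (hv : LinearIndependent ℂ v) (hmem : ∀ h, v h ∈ weightFiltration Γ N (weight h + 1))
    (hsub : ∀ h, w h - v h ∈ weightFiltration Γ N (weight h)) :
    Submodule.span ℂ (Set.range w) = ⊤ := by
  -- by linear independence and dimension, the `v h` of weight less than `k` span the `k`-th step
  have hspan : ∀ k, weightFiltration Γ N k =
      Submodule.span ℂ (Set.range fun h : {h : Config N // weight h < k} => v h.1) := by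
    intro k
    refine (Submodule.eq_of_le_of_finrank_le ?_ ?_).symm
    · rw [Submodule.span_le]
      rintro _ ⟨h, rfl⟩
      exact weightFiltration_mono Γ N h.2 (hmem h.1)
    · have hli : LinearIndependent ℂ fun h : {h : Config N // weight h < k} => v h.1 :=
        hv.comp _ Subtype.val_injective
      rw [finrank_span_eq_card hli]
      exact finrank_range_le_card _
  have hle : ∀ k, weightFiltration Γ N k ≤ Submodule.span ℂ (Set.range w) := by
    intro k
    induction k with
    | zero => rw [weightFiltration_zero]; exact bot_le
    | succ k ih =>
      rw [hspan, Submodule.span_le]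
      rintro _ ⟨⟨h, hh⟩, rfl⟩
      have h1 := ih (weightFiltration_mono Γ N (Nat.lt_succ_iff.mp hh) (hsub h))
      have h2 := sub_mem (Submodule.subset_span (Set.mem_range_self h)) h1
      rwa [sub_sub_cancel] at h2
  rw [eq_top_iff, ← hv.span_eq_top_of_card_eq_finrank' (by simp), Submodule.span_le]
  rintro _ ⟨h, rfl⟩
  exact hle _ (hmem h)

/-- A tensor product covector `s ⊗ ⋯ ⊗ s` generates an SoV basis whenever `s` is not a left
eigenvector of `K`. -/
theorem isSoVBasis_tensorCovector {K : Matrix (Fin 2) (Fin 2) ℂ} {η : ℂ} (hη : η ≠ 0)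
    {ξ : Fin N → ℂ} (hξ : InhomogeneityCondition η ξ) {x y : ℂ}
    (hxy : LinearIndependent ℂ ![![x, y], ![x, y] ᵥ* K]) :
    IsSoVBasis K η ξ (tensorCovector N x y) := by
  set Γ : Matrix (Fin 2) (Fin 2) ℂ := Matrix.of ![![x, y], ![x, y] ᵥ* K] with hΓdef
  have hΓ : IsUnit Γ.det :=
    (Matrix.isUnit_iff_isUnit_det _).mp (Matrix.linearIndependent_rows_iff_isUnit.mp hxy)
  set M : ℂ → Matrix (Fin 2) (Fin 2) (Op N) := fun u => gauge Γ (chain η ξ (sites N) u) with hMdef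
  have hcont : ∀ i j, Continuous fun u => M u i j :=
    continuous_gauge Γ (continuous_chain η ξ (sites N))
  have hRTT : ∀ u w, RTT η (u - w) (M u) (M w) := fun u w =>
    (rtt_chain η ξ nodup_sites u w).gauge Γ
  have hdet : ∀ n, HasQDet (M (ξ n)) (M (ξ n - η)) (aFun η ξ (ξ n) * dFun ξ (ξ n - η)) := fun n => by
    rw [aFun_mul_dFun, ← prod_map_sites]
    exact (hasQDet_chain η ξ nodup_sites (ξ n)).gauge hΓ
  have hq : ∀ n, aFun η ξ (ξ n) * dFun ξ (ξ n - η) ≠ 0 := fun n =>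
    mul_ne_zero (hξ.aFun_ne_zero hη n) (hξ.dFun_ne_zero hη n)
  have hS : tensorCovector N x y = rowTensor Γ 0 := rfl
  have hS0 : tensorCovector N x y ≠ 0 := by
    have : ∃ i, ![x, y] i ≠ 0 := Function.ne_iff.mp (hxy.ne_zero 0)
    obtain ⟨i, hi⟩ := this
    intro h
    have := congrFun h fun _ => i
    exact Finset.prod_ne_zero_iff.mpr (fun _ _ => hi) this
  have hD : ∀ u, tensorCovector N x y ᵥ* M u 1 1 = (∏ n, (u - ξ n)) • tensorCovector N x y :=
    fun u => by
      rw [hS, hMdef, rowTensor_zero_vecMul_gauge_chain hΓ η ξ nodup_sites, prod_map_sites]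
  have hT : ∀ u, transfer K η ξ u = M u 1 0 + (Γ * K * Γ⁻¹) 1 0 • M u 0 1 +
      (Γ * K * Γ⁻¹) 1 1 • M u 1 1 := by
    intro u
    -- the first row of `Γ * K` is the second row of `Γ`, so `Γ * K * Γ⁻¹` is a companion matrix
    have h0 : ∀ j, (Γ * K * Γ⁻¹) 0 j = (1 : Matrix (Fin 2) (Fin 2) ℂ) 1 j := fun j => by
      rw [← Matrix.mul_nonsing_inv _ hΓ, Matrix.mul_apply, Matrix.mul_apply]
      rfl
    have h1 : (scalarAux (Op N) (Γ * K * Γ⁻¹) * M u).trace = transfer K η ξ u := by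
      rw [transfer, monodromy_eq, hMdef]
      simp only [gauge]
      have h2 : scalarAux (Op N) Γ⁻¹ * scalarAux (Op N) Γ = 1 := by
        rw [← map_mul, Matrix.nonsing_inv_mul _ hΓ, map_one]
      rw [map_mul, map_mul, ← mul_assoc, ← mul_assoc, mul_assoc _ _ (scalarAux (Op N) Γ), h2,
        mul_one, trace_mul_scalarAux, mul_assoc, ← mul_assoc, h2, one_mul]
    rw [← h1, trace_scalarAux_mul]
    simp [Fin.sum_univ_two, h0, add_assoc]
  set v : Config N → Config N → ℂ := fun h =>
    tensorCovector N x y ᵥ* ((support h).map fun n => M (ξ n) 1 0).prod with hv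
  have heig := fun h => eigen_list hq hcont hRTT hdet hS0 hD (nodup_support h)
  have hLI : LinearIndependent ℂ v := linearIndependent_of_eigen (D := fun u => M u 1 1) hη hξ
    (fun h => (heig h).1) fun h u => by simpa only [mem_support] using (heig h).2 u
  have htri := fun h : Config N => sub_mem_weightFiltration (M := M) (S := tensorCovector N x y)
    (fun u i j k v hv => vecMul_gauge_chain_mem hΓ η ξ nodup_sites u i j k hv) hT
    (rowTensor_mem_weightFiltration Γ (h := (0 : Config N)) (by simp [weight])) ξ (support h)
  have hspan := span_eq_top_of_triangular hLI (fun h => length_support h ▸ (htri h).1)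
    (fun h => length_support h ▸ (htri h).2)
  have htop : Submodule.span ℂ (Set.range (sovCovector K η ξ (tensorCovector N x y))) = ⊤ := by
    rw [eq_top_iff, ← hspan, Submodule.span_le]
    rintro _ ⟨h, rfl⟩
    have h1 : sovCovector K η ξ (tensorCovector N x y) h =
        ((support h).map fun n => (aFun η ξ (ξ n))⁻¹).prod •
          (tensorCovector N x y ᵥ* ((support h).map fun n => transfer K η ξ (ξ n)).prod) := by
      rw [sovCovector, List.ofFn_eq_map, prod_map_smul_pow, vecMul_smul, support]
    have h2 : ((support h).map fun n => (aFun η ξ (ξ n))⁻¹).prod ≠ 0 := by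
      rw [Ne, List.prod_eq_zero_iff, List.mem_map]
      rintro ⟨n, -, hn⟩
      exact inv_ne_zero (hξ.aFun_ne_zero hη n) hn
    refine (Submodule.smul_mem_iff _ h2).mp ?_
    rw [← h1]
    exact Submodule.subset_span (Set.mem_range_self h)
  exact ⟨linearIndependent_of_top_le_span_of_card_eq_finrank htop.ge (by simp), htop⟩

end Basis

/-! ### Genericity and the proof of the theorem -/

/-- `(x, y)` is a left eigenvector of `K` exactly on the zeros of a quadratic form. -/
theorem det_row_vecMul (K : Matrix (Fin 2) (Fin 2) ℂ) (x y : ℂ) :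
    (Matrix.of ![![x, y], ![x, y] ᵥ* K]).det =
      K 0 1 * x ^ 2 + (K 1 1 - K 0 0) * x * y - K 1 0 * y ^ 2 := by
  simp [Matrix.det_fin_two, Matrix.vecMul, dotProduct, Fin.sum_univ_two]
  ring

/-- Almost every covector of `ℂ²` is no left eigenvector of `K`: for every `x ≠ 0` the determinant of
`(x, y)` and `(x, y) K` is a nonzero polynomial in `y`. -/
theorem ae_linearIndependent {K : Matrix (Fin 2) (Fin 2) ℂ}
    (hK : ∀ α : ℂ, K ≠ α • (1 : Matrix (Fin 2) (Fin 2) ℂ)) :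
    ∀ᵐ p : ℂ × ℂ, LinearIndependent ℂ ![![p.1, p.2], ![p.1, p.2] ᵥ* K] := by
  have hset : ∀ p : ℂ × ℂ, LinearIndependent ℂ ![![p.1, p.2], ![p.1, p.2] ᵥ* K] ↔
      K 0 1 * p.1 ^ 2 + (K 1 1 - K 0 0) * p.1 * p.2 - K 1 0 * p.2 ^ 2 ≠ 0 := by
    intro p
    rw [← det_row_vecMul, ← isUnit_iff_ne_zero, ← Matrix.isUnit_iff_isUnit_det]
    exact Matrix.linearIndependent_rows_iff_isUnit (A := Matrix.of ![![p.1, p.2], ![p.1, p.2] ᵥ* K])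
  simp only [hset]
  have hclosed : IsClosed {p : ℂ × ℂ |
      K 0 1 * p.1 ^ 2 + (K 1 1 - K 0 0) * p.1 * p.2 - K 1 0 * p.2 ^ 2 = 0} :=
    isClosed_eq (by fun_prop) continuous_const
  rw [ae_iff]
  simp only [not_not]
  rw [Measure.volume_eq_prod, Measure.measure_prod_null hclosed.measurableSet]
  filter_upwards [Measure.ae_ne volume (0 : ℂ)] with x hx
  refine Set.Finite.measure_zero ?_ _
  set P : Polynomial ℂ := Polynomial.C (-K 1 0) * Polynomial.X ^ 2 +
    Polynomial.C ((K 1 1 - K 0 0) * x) * Polynomial.X + Polynomial.C (K 0 1 * x ^ 2) with hP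
  have hP0 : P ≠ 0 := by
    intro h0
    have hcoeff : ∀ a b c : ℂ, Polynomial.C a * Polynomial.X ^ 2 + Polynomial.C b * Polynomial.X +
        Polynomial.C c = 0 → a = 0 ∧ b = 0 ∧ c = 0 := by
      intro a b c h
      have c0 := congrArg (Polynomial.coeff · 0) h
      have c1 := congrArg (Polynomial.coeff · 1) h
      have c2 := congrArg (Polynomial.coeff · 2) h
      simp [Polynomial.coeff_X, Polynomial.coeff_C] at c0 c1 c2
      exact ⟨c2, c1, c0⟩
    obtain ⟨h10, h11, h01⟩ := hcoeff _ _ _ h0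
    replace h11 := sub_eq_zero.mp ((mul_eq_zero.mp h11).resolve_right hx)
    replace h01 := (mul_eq_zero.mp h01).resolve_right (pow_ne_zero 2 hx)
    refine hK (K 0 0) ?_
    ext i j
    fin_cases i <;> fin_cases j <;> simp [h01, h11, neg_eq_zero.mp h10]
  refine P.roots.toFinset.finite_toSet.subset fun y hy => ?_
  simp only [Set.mem_preimage, Set.mem_ofPred_eq] at hy
  simp only [Finset.mem_coe, Multiset.mem_toFinset, Polynomial.mem_roots hP0, Polynomial.IsRoot.def]
  simp only [hP, Polynomial.eval_add, Polynomial.eval_mul, Polynomial.eval_C, Polynomial.eval_pow,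
    Polynomial.eval_X]
  linear_combination hy

/-- An eigenvector is determined by its pairing with the generating covector of an SoV basis. -/
theorem IsJointEigen.eq_smul {N : ℕ} {K : Matrix (Fin 2) (Fin 2) ℂ} {η : ℂ} {ξ : Fin N → ℂ}
    {S : Config N → ℂ} (hS : IsSoVBasis K η ξ S) {t : ℂ → ℂ} {v w : Config N → ℂ}
    (hv : IsJointEigen (transfer K η ξ) t v) (hSv : S ⬝ᵥ v = 1)
    (hw : IsJointEigen (transfer K η ξ) t w) : w = (S ⬝ᵥ w) • v := by
  refine Matrix.mulVec_injective_iff_isUnit.mpr (isUnit_sov hS) ?_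
  funext h
  have h1 := sovCovector_dotProduct S hw h
  have h2 := sovCovector_dotProduct S hv h
  rw [hSv, mul_one] at h2
  rw [mulVec_smul]
  change sovCovector K η ξ S h ⬝ᵥ w = (S ⬝ᵥ w) * (sovCovector K η ξ S h ⬝ᵥ v)
  rw [h1, h2, mul_comm]

end SixVertex

open SixVertex
theorem mainTheorem1 (N : ℕ) (K : Matrix (Fin 2) (Fin 2) ℂ) (η : ℂ) (ξ : Fin N → ℂ)
    (hη : η ≠ 0) (hK : ∀ α : ℂ, K ≠ α • (1 : Matrix (Fin 2) (Fin 2) ℂ))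
    (hξ : InhomogeneityCondition η ξ) :
    -- the transfer-matrix eigenvalues
    spectrumOf (transfer K η ξ) = {t | ∃ x ∈ quadraticSolutions K η ξ, t = tPoly K ξ x} ∧
    -- the right-hand sides of the quadratic equations are values of the quantum determinant
    (∀ u, quantumDet K η ξ u = (aFun η ξ u * dFun ξ (u - η) * K.det) • (1 : Op N)) ∧
    -- the spectrum is w-simple
    IsWSimple (transfer K η ξ) ∧
    -- existence of the SoV basis
    (∀ x y : ℂ, LinearIndependent ℂ ![![x, y], ![x, y] ᵥ* K] →
      IsSoVBasis K η ξ (tensorCovector N x y)) ∧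
    (∀ᵐ p : ℂ × ℂ, IsSoVBasis K η ξ (tensorCovector N p.1 p.2)) ∧
    -- factorized wave functions of the eigenvectors in any SoV basis
    (∀ S : Config N → ℂ, IsSoVBasis K η ξ S → ∀ t ∈ spectrumOf (transfer K η ξ),
      ∃ v : Config N → ℂ, IsJointEigen (transfer K η ξ) t v ∧ S ⬝ᵥ v = 1 ∧
        (∀ w, IsJointEigen (transfer K η ξ) t w → S ⬝ᵥ w = 1 → w = v) ∧
        ∀ h : Config N, sovCovector K η ξ S h ⬝ᵥ v =
          ∏ n, (t (ξ n) / aFun η ξ (ξ n)) ^ (h n : ℕ)) := by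
  have hae : ∀ᵐ p : ℂ × ℂ, IsSoVBasis K η ξ (tensorCovector N p.1 p.2) :=
    (ae_linearIndependent hK).mono fun p hp => isSoVBasis_tensorCovector hη hξ hp
  obtain ⟨p, hp⟩ := hae.exists
  -- the eigenvector attached to an eigenvalue by an SoV basis, normalized on `S`
  have hex : ∀ S : Config N → ℂ, IsSoVBasis K η ξ S → ∀ t ∈ spectrumOf (transfer K η ξ),
      ∃ v, IsJointEigen (transfer K η ξ) t v ∧ S ⬝ᵥ v = 1 := by
    intro S hS t ht
    obtain ⟨hx, htx⟩ := exists_quadraticSolution hξ ht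
    obtain ⟨v, hv⟩ := exists_eigenvector hη hξ hS hx
    exact ⟨v, by rwa [← htx] at hv⟩
  have hne : ∀ {S v : Config N → ℂ}, S ⬝ᵥ v = 1 → v ≠ 0 := by
    rintro S v hSv rfl
    simp at hSv
  refine ⟨?_, quantumDet_eq K η ξ, ?_, fun x y => isSoVBasis_tensorCovector hη hξ, hae, ?_⟩
  · ext t
    constructor
    · intro ht
      exact ⟨_, exists_quadraticSolution hξ ht⟩
    · rintro ⟨x, hx, rfl⟩
      obtain ⟨v, hv, hSv⟩ := exists_eigenvector hη hξ hp hx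
      exact ⟨v, hne hSv, hv⟩
  · intro t ht
    obtain ⟨v, hv, hSv⟩ := hex _ hp t ht
    refine ⟨v, hne hSv, fun w => ⟨fun hw => ⟨_, IsJointEigen.eq_smul hp hv hSv hw⟩, ?_⟩⟩
    rintro ⟨c, rfl⟩ u
    rw [mulVec_smul, hv u, smul_comm]
  · intro S hS t ht
    obtain ⟨v, hv, hSv⟩ := hex S hS t ht
    refine ⟨v, hv, hSv, fun w hw hSw => ?_, fun h => ?_⟩
    · rw [IsJointEigen.eq_smul hS hv hSv hw, hSw, one_smul]
    · rw [sovCovector_dotProduct S hv, hSv, mul_one]
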